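/- Work in $\mathbb R^2$ with the stationary, unbounded, non-convex open domain $\Omega=\{(x,y): y>\cos(2\pi x)\}$, whose closure is $\overline\Omega=\{y\ge\cos(2\pi x)\}$, and the potentials $V(x,y)=xy$, $W=0$. For $z\in\partial\Omega$ let $n(z)$ be the outer unit normal, and $n(z)=0$ otherwise; let $P_z(v)=v$ if $v\cdot n(z)\le 0$ and $P_z(v)=v-(v\cdot n(z))\,n(z)$ if $v\cdot n(z)>0$. Let $d_W$ be the 2-Wasserstein distance and $\mathcal P_2(\overline\Omega)$ the set of probability measures on $\overline\Omega$ with finite second moment. A weak solution of $$\partial_t\mu+\nabla\cdot\big(\mu\,P_z(-\nabla V-\nabla W*\mu)\big)=0 \qquad (\ast)$$ on $[0,T]$ with initial datum $\mu_0$ is a $d_W$-absolutely continuous curve $\mu(t)\in\mathcal P_2(\overline\Omega)$, $t\in[0,T]$, with $\mu(0)=\mu_0$ such that $v=P_z(-\nabla V-\nabla W*\mu)\in L^1_{loc}([0,T);L^2(\mu(t)))$ and $\int_0^T\!\int(\partial_t\varphi+\nabla\varphi\cdot v)\,d\mu(t)\,dt=0$ for all $\varphi\in C_c^\infty(\mathbb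 R^2\times(0,T))$. A global weak solution is one on $[0,T]$ for every $T>0$. For $R>0$ put $\delta(R,\mu)=\int_{\{|z|\ge R\}}|z|^2\,d\mu$. A measure $\mu$ satisfies (R) with constant $c>0$ if $\delta(R,\mu)e^{cR}\to0$ as $R\to\infty$, and it satisfies (R) if it does so with some $c>0$. **Theorem.** The domain $\Omega$ is nonempty and open, has $C^1$ boundary, and is prox-regular: there is $r>0$ with $n(z)\cdot(w-z)\le|w-z|^2/r$ for all $z\in\partial\Omega$, $w\in\Omega$. The functions $V,W$ are $C^1$ with gradients of at most linear growth, $W$ is even, and for some $\lambda\in\mathbb R$ both are $\lambda$-convex, i.e. $(\nabla f(z)-\nabla f(w))\cdot(z-w)\ge\lambda|z-w|^2$ for all $z,w$. Moreover, for every $t_0>0$ the following hold. (i) There are $\mu_0,\mu_0^n\in\mathcal P_2(\overline\Omega)$ $(n\in\mathbb N)$ with $0<d_W(\mu_0,\mu_0^n)\to0$, and global weak solutions $\mu(\cdot),\mu^n(\cdot)$ of $(\ast)$ with initial data $\mu_0,\mu_0^n$, such that for every $T>0$ there is one constant $c>0$ with which all $\mu(t)$ and $\mu^n(t)$, $t\in[0,T]$,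 $n\in\mathbb N$, satisfy (R), and $$\liminf_{n\to\infty}\frac{d_W(\mu(t_0),\mu^n(t_0))}{d_W(\mu_0,\mu^n_0)}=+\infty .$$ (ii) For every $p>\tfrac12$ there are $\mu_0,\mu_0^n\in\mathcal P_2(\overline\Omega)$ with $0<d_W(\mu_0,\mu_0^n)\to0$, none of which satisfies (R), but all of which have polynomial decay with the same constants (for some $C$ and $q>0$, $\delta(R,\cdot)\le CR^{-q}$ for all $R\ge1$), and global weak solutions $\mu(\cdot),\mu^n(\cdot)$ of $(\ast)$ with initial data $\mu_0,\mu_0^n$, such that $$\liminf_{n\to\infty}\frac{d_W(\mu(t_0),\mu^n(t_0))}{d_W(\mu_0,\mu^n_0)^{\,p}}=+\infty .$$ -/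

import Mathlib

open MeasureTheory Filter Topology Set
open scoped ENNReal

noncomputable section

namespace ProjectedFlow

/-- Euclidean space of dimension `d`. -/
abbrev Rd (d : ℕ) := EuclideanSpace ℝ (Fin d)

/-! ### The space of probability measures with finite second moment -/

/-- `μ` is a probability measure on the (closed) set `S` with finite second moment, seen as a
measure on the whole space that vanishes outside `S`. -/
structure MemP2 {d : ℕ} (S : Set (Rd d)) (μ : Measure (Rd d)) : Prop where
  isProb : IsProbabilityMeasure μ
  null_compl : μ Sᶜ = 0
  secondMoment : ∫⁻ x, ‖x‖ₑ ^ 2 ∂μ < ⊤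

/-- Transport plans: measures on the product with marginals `μ` and `ν`. -/
def plans {d : ℕ} (μ ν : Measure (Rd d)) : Set (Measure (Rd d × Rd d)) :=
  {γ | γ.fst = μ ∧ γ.snd = ν}

/-- The 2-Wasserstein distance, with values in `[0, ∞]` (finite between measures with finite
second moment). -/
def dW {d : ℕ} (μ ν : Measure (Rd d)) : ℝ≥0∞ :=
  (⨅ γ ∈ plans μ ν, ∫⁻ z, edist z.1 z.2 ^ 2 ∂γ) ^ (1 / 2 : ℝ)

/-- Absolute continuity of a curve of measures on `[0, T]` for the Wasserstein distance. -/
def AbsContCurve {d : ℕ} (T : ℝ) (μ : ℝ → Measure (Rd d)) : Prop :=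
  ∃ m : ℝ → ℝ, IntegrableOn m (Icc 0 T) ∧
    ∀ s t, 0 ≤ s → s ≤ t → t ≤ T → dW (μ s) (μ t) ≤ ENNReal.ofReal (∫ r in s..t, m r)

/-! ### Domains -/

/-- `n` is the outer unit normal of `Ω` at the boundary point `x`: near `x`, the set `Ω` is a
sublevel set `{F < 0}` of a `C¹` function with nonvanishing gradient, and `n = ∇F / |∇F|` at `x`.
There is at most one such `n`. -/
def IsOuterUnitNormal {d : ℕ} (Ω : Set (Rd d)) (x n : Rd d) : Prop :=
  x ∈ frontier Ω ∧ ∃ F : Rd d → ℝ, ContDiffAt ℝ 1 F x ∧ gradient F x ≠ 0 ∧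
    (∀ᶠ y in 𝓝 x, y ∈ Ω ↔ F y < 0) ∧ n = ‖gradient F x‖⁻¹ • gradient F x

/-- `Ω` has a `C¹` boundary. -/
def HasC1Boundary {d : ℕ} (Ω : Set (Rd d)) : Prop :=
  ∀ x ∈ frontier Ω, ∃ n, IsOuterUnitNormal Ω x n

open Classical in
/-- The outer unit normal field of a domain with `C¹` boundary, extended by `0` to the points that
are not on the boundary. -/
def outerNormal {d : ℕ} (Ω : Set (Rd d)) (x : Rd d) : Rd d :=
  if h : ∃ n, IsOuterUnitNormal Ω x n then h.choose else 0

/-- `r`-prox-regularity. -/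
def ProxRegular {d : ℕ} (Ω : Set (Rd d)) (r : ℝ) : Prop :=
  ∀ x ∈ frontier Ω, ∀ y ∈ Ω, inner ℝ (outerNormal Ω x) (y - x) ≤ ‖y - x‖ ^ 2 / r

/-- The condition on the domain, for a stationary domain (whose boundary speed is `0`): a nonempty
open set with `C¹` boundary that is `r`-prox-regular for some `r > 0`. -/
structure ConditionO1 {d : ℕ} (Ω : Set (Rd d)) : Prop where
  isOpen : IsOpen Ω
  nonempty : Ω.Nonempty
  c1Boundary : HasC1Boundary Ω
  proxRegular : ∃ r > 0, ProxRegular Ω r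

open Classical in
/-- The projection operator at the point `x` for a stationary domain (boundary speed `0`). -/
def proj {d : ℕ} (Ω : Set (Rd d)) (x v : Rd d) : Rd d :=
  if inner ℝ v (outerNormal Ω x) ≤ 0 then v
  else v - inner ℝ v (outerNormal Ω x) • outerNormal Ω x

/-! ### Potentials -/

/-- The external potential is `C¹` and its gradient grows at most linearly. -/
structure ConditionC1 {d : ℕ} (V : Rd d → ℝ) : Prop where
  contDiff : ContDiff ℝ 1 V
  growth : ∃ C : ℝ, ∀ x, ‖gradient V x‖ ≤ C * (1 + ‖x‖)

/-- The interaction potential is `C¹` and even and its gradient grows at most linearly.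
(The further requirement `W ∈ C²` is made only when the boundary moves inwards somewhere,
never for a stationary domain.) -/
structure ConditionC2 {d : ℕ} (W : Rd d → ℝ) : Prop where
  contDiff : ContDiff ℝ 1 W
  growth : ∃ C : ℝ, ∀ x, ‖gradient W x‖ ≤ C * (1 + ‖x‖)
  even : ∀ x, W (-x) = W x

/-- `lam`-convexity on the whole space of a `C¹` function. -/
def LambdaConvex {d : ℕ} (lam : ℝ) (f : Rd d → ℝ) : Prop :=
  ∀ x y, lam * ‖x - y‖ ^ 2 ≤ inner ℝ (gradient f x - gradient f y) (x - y)

/-- Both potentials are `lam`-convex for some real `lam`. -/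
def ConditionC3 {d : ℕ} (V W : Rd d → ℝ) : Prop :=
  ∃ lam : ℝ, LambdaConvex lam V ∧ LambdaConvex lam W

/-! ### Weak solutions -/

/-- The projected velocity field `P_x (-∇V - ∇W * μ)`. -/
def velocity {d : ℕ} (Ω : Set (Rd d)) (V W : Rd d → ℝ) (μ : Measure (Rd d)) (x : Rd d) : Rd d :=
  proj Ω x (-gradient V x - ∫ y, gradient W (x - y) ∂μ)

/-- `μ` is a weak solution for `t ∈ [0, T]`, with initial datum `μ₀`, of
`∂ₜ μ + ∇ · (μ P_x (-∇V - ∇W * μ)) = 0` in the closure of the stationary domain `Ω`. -/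
structure IsWeakSolution {d : ℕ} (Ω : Set (Rd d)) (V W : Rd d → ℝ) (T : ℝ)
    (μ₀ : Measure (Rd d)) (μ : ℝ → Measure (Rd d)) : Prop where
  initial : μ 0 = μ₀
  memP2 : ∀ t ∈ Icc 0 T, MemP2 (closure Ω) (μ t)
  absCont : AbsContCurve T μ
  /-- the velocity lies in `L¹_loc([0, T); L²(μ(t)))`: its slices are square integrable -/
  velocity_memLp : ∀ᵐ t, t ∈ Ioo 0 T → MemLp (velocity Ω V W (μ t)) 2 (μ t)
  /-- the velocity lies in `L¹_loc([0, T); L²(μ(t)))`: the norms are locally integrable -/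
  velocity_integrable : ∀ T', T' < T →
    IntegrableOn (fun t => (eLpNorm (velocity Ω V W (μ t)) 2 (μ t)).toReal) (Icc 0 T')
  /-- the equation, tested against `φ ∈ C_c^∞(ℝᵈ × (0, T))` -/
  weak : ∀ φ : Rd d × ℝ → ℝ, ContDiff ℝ ((⊤ : ℕ∞) : WithTop ℕ∞) φ → HasCompactSupport φ →
    tsupport φ ⊆ univ ×ˢ Ioo 0 T →
    ∫ t in Ioo 0 T, ∫ x, (deriv (fun s => φ (x, s)) t +
      inner ℝ (gradient (fun y => φ (y, t)) x) (velocity Ω V W (μ t) x)) ∂(μ t) = 0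

/-- A weak solution for all times: a weak solution on `[0, T]` for every `T > 0`. -/
def IsGlobalWeakSolution {d : ℕ} (Ω : Set (Rd d)) (V W : Rd d → ℝ)
    (μ₀ : Measure (Rd d)) (μ : ℝ → Measure (Rd d)) : Prop :=
  ∀ T : ℝ, 0 < T → IsWeakSolution Ω V W T μ₀ μ

/-! ### Decay at infinity -/

/-- The second moment outside the ball of radius `R`. -/
def tail {d : ℕ} (R : ℝ) (μ : Measure (Rd d)) : ℝ≥0∞ :=
  ∫⁻ x in (Metric.ball (0 : Rd d) R)ᶜ, ‖x‖ₑ ^ 2 ∂μ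

/-- The exponential decay condition with the constant `c`. -/
def ConditionRWith {d : ℕ} (c : ℝ) (μ : Measure (Rd d)) : Prop :=
  Tendsto (fun R : ℝ => tail R μ * ENNReal.ofReal (Real.exp (c * R))) atTop (𝓝 0)

/-- The exponential decay condition (R). -/
def ConditionR {d : ℕ} (μ : Measure (Rd d)) : Prop :=
  ∃ c > 0, ConditionRWith c μ

/-- Polynomial decay with exponent `q` and constant `C`. -/
def PolynomialDecayWith {d : ℕ} (C q : ℝ) (μ : Measure (Rd d)) : Prop :=
  ∀ R : ℝ, 1 ≤ R → tail R μ ≤ ENNReal.ofReal (C * R ^ (-q))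

/-! ### The example -/

/-- The open set `y > cos (2 π x)` in the plane; its closure is `y ≥ cos (2 π x)`. -/
def cosDomain : Set (Rd 2) := {z | Real.cos (2 * Real.pi * z 0) < z 1}

/-- The external potential `V(x, y) = x y`. -/
def saddle : Rd 2 → ℝ := fun z => z 0 * z 1

/-- The interaction potential `W = 0`. -/
def zeroPotential : Rd 2 → ℝ := fun _ => 0

/-- `μ`, `μn n` are global weak solutions, in the closure of `cosDomain` and for the potentials
`saddle` and `zeroPotential`, with initial data `μ₀`, `μ₀n n`, and the data `μ₀n n`, all distinct
from `μ₀`, converge to `μ₀` in the Wasserstein distance. -/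
structure PerturbedSolutions (μ₀ : Measure (Rd 2)) (μ₀n : ℕ → Measure (Rd 2))
    (μ : ℝ → Measure (Rd 2)) (μn : ℕ → ℝ → Measure (Rd 2)) : Prop where
  data_memP2 : MemP2 (closure cosDomain) μ₀
  datan_memP2 : ∀ n, MemP2 (closure cosDomain) (μ₀n n)
  solution : IsGlobalWeakSolution cosDomain saddle zeroPotential μ₀ μ
  solutionn : ∀ n, IsGlobalWeakSolution cosDomain saddle zeroPotential (μ₀n n) (μn n)
  dist_ne_zero : ∀ n, dW μ₀ (μ₀n n) ≠ 0
  dist_tendsto : Tendsto (fun n => dW μ₀ (μ₀n n)) atTop (𝓝 0)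

end ProjectedFlow

end

namespace ProjectedFlow

/-! ### Geometry of the domain -/

/-! The force `-∇V = (-y, -x)` presses a particle on the boundary with `x ≥ 4` against the curve `y
= cos (2πx)`, with a strength that grows like `x`. What survives the projection is the tangential
part, so the particle slides along the curve as a bead under gravity of size `x`. Near the top of
the hill at `x = N` there is an equilibrium `p_N`, and it repels at a rate at least `N / 2`.
Prox-regularity does not prevent this: its quadratic error is multiplied by the size of the force,
so no expansion rate is uniform on the unbounded domain.

Put a mass `w_n` on the equilibrium of hill `n + 4`, for every `n`. This measure does not move. For
the `n`-th perturbation, shift only the `n`-th atom, to the position from which it arrives at `n + 4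
+ 1/6` at time `t₀`. Solving the boundary equation backwards shows that this shift is at most `exp
(-n t₀ / 2)` (`lt_cosSpeed`, `exists_trajectory`). Since `W = 0`, atoms do not interact, and a
resting measure plus one moving atom is a weak solution (`isGlobalWeakSolution_add_dirac`).

At time `t₀` the distance is at least `√(w_n) / 12`, because some mass `w_n` must reach a point away
from the support of the resting measure (`le_dW_of_atom`). At time `0` it is at most `8 exp (-n t₀ /
2)`, by moving that atom alone (`dW_add_dirac_le`). The quotient with exponent `q` therefore blows
up once `√(w_n) exp (q n t₀ / 2) → ∞`. Geometric weights with a slow enough rate give this for `q =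
1` and keep exponential decay. Polynomial weights give it for every positive exponent, in particular
above `1/2`, and violate (R). -/

/-- Needed because `outerNormal` is a choice. A direction strictly decreasing for one defining
function enters `Ω`, so it cannot be strictly increasing for the other. If the unit normals `a`, `b`
differed, `a - b` would be such a direction. -/
theorem IsOuterUnitNormal.unique {d : ℕ} {Ω : Set (Rd d)} (hΩ : IsOpen Ω) {x a b : Rd d}
    (ha : IsOuterUnitNormal Ω x a) (hb : IsOuterUnitNormal Ω x b) : a = b := by
  obtain ⟨hx, F, hF, hF0, hFΩ, rfl⟩ := ha
  obtain ⟨-, G, hG, hG0, hGΩ, rfl⟩ := hb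
  have hxΩ : x ∉ Ω := by
    rw [hΩ.frontier_eq] at hx
    exact hx.2
  -- If `G x` were positive, `Ω` would miss a neighbourhood of `x`, although `x` lies in its
  -- closure.
  have hGx : G x = 0 := by
    refine le_antisymm ?_ (not_lt.1 fun h => hxΩ (hGΩ.self_of_nhds.2 h))
    by_contra! hpos
    have hev : ∀ᶠ y in 𝓝 x, 0 < G y := hG.continuousAt.eventually (lt_mem_nhds hpos)
    have hfr : ∃ᶠ y in 𝓝 x, y ∈ Ω := mem_closure_iff_frequently.1 (frontier_subset_closure hx)
    obtain ⟨y, hy, hy1, hy2⟩ := (hfr.and_eventually (hev.and hGΩ)).exists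
    exact absurd (hy2.1 hy) (not_lt.2 hy1.le)
  have hFx : 0 ≤ F x := not_lt.1 fun h => hxΩ (hFΩ.self_of_nhds.2 h)
  have line : ∀ (H : Rd d → ℝ), ContDiffAt ℝ 1 H x → ∀ u : Rd d,
      HasDerivAt (fun s : ℝ => H (x + s • u)) (inner ℝ (gradient H x) u) 0 := by
    intro H hH u
    have h1 : HasFDerivAt H (InnerProductSpace.toDual ℝ _ (gradient H x)) (x + (0 : ℝ) • u) := by
      simpa using (hH.differentiableAt one_ne_zero).hasGradientAt.hasFDerivAt
    have h2 : HasDerivAt (fun s : ℝ => x + s • u) u 0 := by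
      simpa using ((hasDerivAt_id (0 : ℝ)).smul_const u).const_add x
    have h3 := h1.comp_hasDerivAt (0 : ℝ) h2
    rw [InnerProductSpace.toDual_apply_apply] at h3
    exact h3
  have key : ∀ u : Rd d, inner ℝ (gradient G x) u < 0 → inner ℝ (gradient F x) u ≤ 0 := by
    intro u hu
    by_contra! hpos
    have tl : Tendsto (fun s : ℝ => x + s • u) (𝓝[>] 0) (𝓝 x) := by
      have : Continuous fun s : ℝ => x + s • u := by fun_prop
      simpa using (this.tendsto 0).mono_left nhdsWithin_le_nhds
    have slope_sign : ∀ H : Rd d → ℝ, ContDiffAt ℝ 1 H x →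
        Tendsto (fun s : ℝ => s⁻¹ * (H (x + s • u) - H x)) (𝓝[>] 0)
          (𝓝 (inner ℝ (gradient H x) u)) := by
      intro H hH
      have := (line H hH u).tendsto_slope_zero_right
      simpa using this
    have h1 := (slope_sign G hG).eventually (gt_mem_nhds hu)
    have h2 := (slope_sign F hF).eventually (lt_mem_nhds hpos)
    obtain ⟨s, hs1, hs2, hs3, hs4, hs5⟩ := (h1.and (h2.and ((tl.eventually hFΩ).and
      ((tl.eventually hGΩ).and self_mem_nhdsWithin)))).exists
    have hs0 : 0 < s⁻¹ := inv_pos.2 hs5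
    have hGneg : G (x + s • u) < 0 := by
      rw [hGx] at hs1
      nlinarith [neg_of_mul_neg_right hs1 hs0.le]
    have hFneg := hs3.1 (hs4.2 hGneg)
    have : 0 < F (x + s • u) - F x := pos_of_mul_pos_right hs2 hs0.le
    linarith
  have nF : 0 < ‖gradient F x‖ := norm_pos_iff.2 hF0
  have nG : 0 < ‖gradient G x‖ := norm_pos_iff.2 hG0
  set a := ‖gradient F x‖⁻¹ • gradient F x with ha
  set b := ‖gradient G x‖⁻¹ • gradient G x with hb
  have na : ‖a‖ = 1 := norm_smul_inv_norm hF0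
  have nb : ‖b‖ = 1 := norm_smul_inv_norm hG0
  by_contra hab
  have hlt : inner ℝ a b < 1 := (inner_lt_one_iff_real_of_norm_eq_one na nb).2 hab
  have eF : gradient F x = ‖gradient F x‖ • a := by
    rw [ha, smul_smul, mul_inv_cancel₀ nF.ne', one_smul]
  have eG : gradient G x = ‖gradient G x‖ • b := by
    rw [hb, smul_smul, mul_inv_cancel₀ nG.ne', one_smul]
  have h := key (a - b) (by
    rw [eG, real_inner_smul_left, inner_sub_right, real_inner_self_eq_norm_sq, nb,
      real_inner_comm]
    nlinarith)
  rw [eF, real_inner_smul_left, inner_sub_right, real_inner_self_eq_norm_sq, na] at h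
  nlinarith

theorem outerNormal_eq {d : ℕ} {Ω : Set (Rd d)} (hΩ : IsOpen Ω) {x n : Rd d}
    (h : IsOuterUnitNormal Ω x n) : outerNormal Ω x = n := by
  have hex : ∃ n, IsOuterUnitNormal Ω x n := ⟨n, h⟩
  rw [outerNormal, dif_pos hex]
  exact hex.choose_spec.unique hΩ h

/-- The point with abscissa `x` on the curve `y = cos (2 π x)`. -/
noncomputable def cosPoint (x : ℝ) : Rd 2 := !₂[x, Real.cos (2 * Real.pi * x)]

/-- The (non-normalised) outer normal of `cosDomain` at `cosPoint x`. -/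
noncomputable def cosNormal (x : ℝ) : Rd 2 := !₂[-(2 * Real.pi * Real.sin (2 * Real.pi * x)), -1]

theorem isOpen_cosDomain : IsOpen cosDomain := by
  unfold cosDomain
  exact isOpen_lt (by fun_prop) (by fun_prop)

theorem closure_cosDomain : closure cosDomain = {z | Real.cos (2 * Real.pi * z 0) ≤ z 1} := by
  refine subset_antisymm (closure_minimal (fun z hz => le_of_lt (show Real.cos (2 * Real.pi * z 0) < z 1 from hz))
    (isClosed_le (by fun_prop) (by fun_prop))) fun z hz => ?_
  rw [mem_closure_iff_seq_limit]
  refine ⟨fun k => z + ((1 : ℝ) / ((k : ℝ) + 1)) • !₂[0, 1], fun k => ?_, ?_⟩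
  · have : (0 : ℝ) < 1 / ((k : ℝ) + 1) := by positivity
    simp [cosDomain] at hz this ⊢
    linarith [inv_pos.2 this]
  · have := (tendsto_one_div_add_atTop_nhds_zero_nat (𝕜 := ℝ)).smul_const (!₂[0, 1] : Rd 2)
    simpa using this.const_add z

theorem frontier_cosDomain : frontier cosDomain = range cosPoint := by
  rw [isOpen_cosDomain.frontier_eq, closure_cosDomain]
  ext z
  simp only [cosDomain, Set.mem_sdiff, mem_ofPred_eq, not_lt, mem_range]
  constructor
  · rintro ⟨h1, h2⟩
    refine ⟨z 0, ?_⟩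
    ext i
    fin_cases i
    · simp [cosPoint]
    · simpa [cosPoint] using le_antisymm h1 h2
  · rintro ⟨x, rfl⟩
    simp [cosPoint]

theorem cosPoint_mem_closure (x : ℝ) : cosPoint x ∈ closure cosDomain := by
  simp [closure_cosDomain, cosPoint]

theorem hasGradientAt_cos_sub (z : Rd 2) :
    HasGradientAt (fun w : Rd 2 => Real.cos (2 * Real.pi * w 0) - w 1) (cosNormal (z 0)) z := by
  rw [hasGradientAt_iff_hasFDerivAt]
  have h0 := (EuclideanSpace.proj (𝕜 := ℝ) (0 : Fin 2)).hasFDerivAt (x := z)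
  have h1 := (EuclideanSpace.proj (𝕜 := ℝ) (1 : Fin 2)).hasFDerivAt (x := z)
  refine (((h0.const_mul (2 * Real.pi)).cos).sub h1).congr_fderiv ?_
  ext v
  simp [cosNormal, PiLp.inner_apply, Fin.sum_univ_two]
  ring

theorem norm_cosNormal_sq (x : ℝ) :
    ‖cosNormal x‖ ^ 2 = 1 + (2 * Real.pi * Real.sin (2 * Real.pi * x)) ^ 2 := by
  simp [EuclideanSpace.norm_sq_eq, cosNormal, Fin.sum_univ_two]
  ring

theorem one_le_norm_cosNormal (x : ℝ) : 1 ≤ ‖cosNormal x‖ := by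
  have h := norm_cosNormal_sq x
  nlinarith [sq_nonneg (2 * Real.pi * Real.sin (2 * Real.pi * x)), norm_nonneg (cosNormal x)]

theorem isOuterUnitNormal_cosPoint (x : ℝ) :
    IsOuterUnitNormal cosDomain (cosPoint x) (‖cosNormal x‖⁻¹ • cosNormal x) := by
  have hg : gradient (fun w : Rd 2 => Real.cos (2 * Real.pi * w 0) - w 1) (cosPoint x)
      = cosNormal x := by
    simpa [cosPoint] using (hasGradientAt_cos_sub (cosPoint x)).gradient
  refine ⟨by rw [frontier_cosDomain]; exact mem_range_self x,
    fun w => Real.cos (2 * Real.pi * w 0) - w 1, ?_, ?_, ?_, by rw [hg]⟩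
  · apply ContDiff.contDiffAt
    fun_prop
  · rw [hg]
    exact norm_pos_iff.1 (by linarith [one_le_norm_cosNormal x])
  · exact Eventually.of_forall fun w => by simp [cosDomain]

theorem outerNormal_cosPoint (x : ℝ) :
    outerNormal cosDomain (cosPoint x) = ‖cosNormal x‖⁻¹ • cosNormal x :=
  outerNormal_eq isOpen_cosDomain (isOuterUnitNormal_cosPoint x)

theorem abs_sin_sub_self_le (b : ℝ) : |Real.sin b - b| ≤ 2 * b ^ 2 := by
  wlog hb : 0 ≤ b generalizing b
  · have := this (-b) (by linarith)
    rw [Real.sin_neg, ← abs_neg] at this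
    rw [neg_sq] at this
    convert this using 2
    ring
  have h1 := Real.sin_le hb
  rw [abs_of_nonpos (by linarith)]
  -- For `b ≤ 1` the cubic bound on the sine suffices; for `b > 1`, `b + 1 ≤ 2 b²`.
  rcases le_or_gt b 1 with h | h
  · rcases hb.eq_or_lt with rfl | hb0
    · simp
    · nlinarith [Real.sin_gt_sub_cube hb0, pow_pos hb0 2]
  · nlinarith [Real.neg_one_le_sin b]

/-- A second-order Taylor remainder with a crude constant. With `b = 2π (w 0 - x)` it is the
prox-regularity inequality for the unnormalised normal, which produces the constant `12 π²`. -/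
theorem cos_sub_cos_add_le (a b : ℝ) :
    Real.cos a - Real.cos (a + b) - b * Real.sin a ≤ 3 * b ^ 2 := by
  have h1 := Real.one_sub_sq_div_two_le_cos (x := b)
  have h2 := abs_le.1 (abs_sin_sub_self_le b)
  have h3 : Real.cos a * (1 - Real.cos b) ≤ b ^ 2 := by
    nlinarith [Real.cos_le_one a, Real.cos_le_one b]
  have h4 : Real.sin a * (Real.sin b - b) ≤ 2 * b ^ 2 := by
    refine (le_abs_self _).trans ?_
    rw [abs_mul]
    have := Real.abs_sin_le_one a
    nlinarith [abs_sin_sub_self_le b, abs_nonneg (Real.sin b - b)]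
  rw [Real.cos_add]
  nlinarith

theorem proxRegular_cosDomain : ProxRegular cosDomain (1 / (12 * Real.pi ^ 2)) := by
  intro z hz w hw
  rw [frontier_cosDomain] at hz
  obtain ⟨x, rfl⟩ := hz
  rw [outerNormal_cosPoint, real_inner_smul_left]
  have hpi := Real.pi_pos
  have hn := one_le_norm_cosNormal x
  have h1 : inner ℝ (cosNormal x) (w - cosPoint x) ≤ 12 * Real.pi ^ 2 * ‖w - cosPoint x‖ ^ 2 := by
    have e : inner ℝ (cosNormal x) (w - cosPoint x) =
        -(2 * Real.pi * Real.sin (2 * Real.pi * x)) * (w 0 - x)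
          - (w 1 - Real.cos (2 * Real.pi * x)) := by
      simp [cosNormal, cosPoint, PiLp.inner_apply, Fin.sum_univ_two]
      ring
    have e2 : ‖w - cosPoint x‖ ^ 2 = (w 0 - x) ^ 2 + (w 1 - Real.cos (2 * Real.pi * x)) ^ 2 := by
      simp [EuclideanSpace.norm_sq_eq, cosPoint, Fin.sum_univ_two]
    have h := cos_sub_cos_add_le (2 * Real.pi * x) (2 * Real.pi * (w 0 - x))
    have hw' : Real.cos (2 * Real.pi * w 0) < w 1 := hw
    rw [show 2 * Real.pi * x + 2 * Real.pi * (w 0 - x) = 2 * Real.pi * w 0 by ring] at h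
    rw [e, e2]
    have : 0 ≤ Real.pi ^ 2 * (w 1 - Real.cos (2 * Real.pi * x)) ^ 2 := by positivity
    nlinarith
  have h2 : 0 ≤ 12 * Real.pi ^ 2 * ‖w - cosPoint x‖ ^ 2 := by positivity
  have h3 : ‖w - cosPoint x‖ ^ 2 / (1 / (12 * Real.pi ^ 2))
      = 12 * Real.pi ^ 2 * ‖w - cosPoint x‖ ^ 2 := by
    field_simp
  rw [h3, inv_mul_le_iff₀ (by linarith)]
  nlinarith

theorem conditionO1_cosDomain : ConditionO1 cosDomain where
  isOpen := isOpen_cosDomain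
  nonempty := ⟨!₂[0, 2], by simp [cosDomain]⟩
  c1Boundary := by
    intro z hz
    rw [frontier_cosDomain] at hz
    obtain ⟨x, rfl⟩ := hz
    exact ⟨_, isOuterUnitNormal_cosPoint x⟩
  proxRegular := ⟨_, by have := Real.pi_pos; positivity, proxRegular_cosDomain⟩

theorem not_convex_cosDomain : ¬ Convex ℝ cosDomain := by
  intro h
  have e : 2 * Real.pi * (2⁻¹ : ℝ) = Real.pi := by ring
  -- Two points above neighbouring valleys, whose midpoint lies under the hill at the origin.
  have h1 : (!₂[2⁻¹, 0] : Rd 2) ∈ cosDomain := by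
    simp [cosDomain, e]
  have h2 : (!₂[-2⁻¹, 0] : Rd 2) ∈ cosDomain := by
    simp [cosDomain, e]
  have := h h1 h2 (a := 1 / 2) (b := 1 / 2) (by norm_num) (by norm_num) (by norm_num)
  norm_num [cosDomain] at this

theorem not_isBounded_cosDomain : ¬ Bornology.IsBounded cosDomain := by
  intro h
  obtain ⟨C, hC⟩ := h.exists_norm_le
  have h1 := hC !₂[0, |C| + 2] (by
    simp [cosDomain]
    linarith [abs_nonneg C])
  have h2 := (PiLp.norm_apply_le (!₂[0, |C| + 2] : Rd 2) 1).trans h1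
  simp at h2
  linarith [le_abs_self (|C| + 2), le_abs_self C]

/-! ### The potentials -/

theorem hasGradientAt_saddle (z : Rd 2) : HasGradientAt saddle !₂[z 1, z 0] z := by
  rw [hasGradientAt_iff_hasFDerivAt]
  have h0 := (EuclideanSpace.proj (𝕜 := ℝ) (0 : Fin 2)).hasFDerivAt (x := z)
  have h1 := (EuclideanSpace.proj (𝕜 := ℝ) (1 : Fin 2)).hasFDerivAt (x := z)
  refine (h0.mul h1).congr_fderiv ?_
  ext v
  simp [PiLp.inner_apply, Fin.sum_univ_two]
  ring

theorem gradient_saddle (z : Rd 2) : gradient saddle z = !₂[z 1, z 0] :=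
  (hasGradientAt_saddle z).gradient

theorem gradient_zeroPotential (z : Rd 2) : gradient zeroPotential z = 0 := by
  unfold zeroPotential
  exact gradient_fun_const z 0

theorem conditionC1_saddle : ConditionC1 saddle where
  contDiff := by unfold saddle; fun_prop
  growth := ⟨1, fun z => by
    have : ‖gradient saddle z‖ = ‖z‖ := by
      rw [gradient_saddle, EuclideanSpace.norm_eq, EuclideanSpace.norm_eq]
      simp [Fin.sum_univ_two, add_comm]
    linarith⟩

theorem conditionC2_zeroPotential : ConditionC2 zeroPotential where
  contDiff := contDiff_const
  growth := ⟨0, fun z => by simp [gradient_zeroPotential]⟩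
  even := fun _ => rfl

theorem conditionC3_saddle : ConditionC3 saddle zeroPotential := by
  -- The Hessian of `x y` has eigenvalues `±1`.
  refine ⟨-1, fun z w => ?_, fun z w => ?_⟩
  · simp only [gradient_saddle, EuclideanSpace.norm_sq_eq, PiLp.inner_apply, Fin.sum_univ_two]
    simp
    nlinarith [sq_nonneg (z 0 - w 0 + (z 1 - w 1))]
  · simp [gradient_zeroPotential]

/-! ### The projected velocity on the boundary -/

/-- The horizontal speed of the projected flow at `cosPoint x`, for `x` large. -/
noncomputable def cosSpeed (x : ℝ) : ℝ :=
  (2 * Real.pi * x * Real.sin (2 * Real.pi * x) - Real.cos (2 * Real.pi * x)) /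
    (1 + (2 * Real.pi * Real.sin (2 * Real.pi * x)) ^ 2)

/-- The force pairs with the unnormalised normal to `x + 2π sin cos ≥ x - π`, which is positive for
`x ≥ 4`. Hence the projection is active and only the tangential component remains. -/
theorem velocity_cosPoint (μ : Measure (Rd 2)) {x : ℝ} (hx : 4 ≤ x) :
    velocity cosDomain saddle zeroPotential μ (cosPoint x) =
      cosSpeed x • !₂[1, -(2 * Real.pi * Real.sin (2 * Real.pi * x))] := by
  have hN := norm_cosNormal_sq x
  have hn := one_le_norm_cosNormal x
  have hv : -gradient saddle (cosPoint x) - ∫ y, gradient zeroPotential (cosPoint x - y) ∂μ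
      = !₂[-Real.cos (2 * Real.pi * x), -x] := by
    simp only [gradient_zeroPotential, gradient_saddle, integral_zero, sub_zero]
    ext i
    fin_cases i <;> simp [cosPoint]
  rw [velocity, hv, proj, outerNormal_cosPoint]
  have hi : inner ℝ (!₂[-Real.cos (2 * Real.pi * x), -x] : Rd 2) (cosNormal x) =
      x + 2 * Real.pi * (Real.sin (2 * Real.pi * x) * Real.cos (2 * Real.pi * x)) := by
    simp [cosNormal, PiLp.inner_apply, Fin.sum_univ_two]
    ring
  have hsc : -(1 / 2) ≤ Real.sin (2 * Real.pi * x) * Real.cos (2 * Real.pi * x) := by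
    nlinarith [Real.sin_sq_add_cos_sq (2 * Real.pi * x),
      sq_nonneg (Real.sin (2 * Real.pi * x) + Real.cos (2 * Real.pi * x))]
  have hpos : 0 < x + 2 * Real.pi * (Real.sin (2 * Real.pi * x) * Real.cos (2 * Real.pi * x)) := by
    nlinarith [Real.pi_pos, Real.pi_lt_four]
  rw [real_inner_smul_right, hi, if_neg (by rw [not_le]; positivity), smul_smul]
  have e : ‖cosNormal x‖⁻¹ * (x + 2 * Real.pi * (Real.sin (2 * Real.pi * x) *
      Real.cos (2 * Real.pi * x))) * ‖cosNormal x‖⁻¹ =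
      (x + 2 * Real.pi * (Real.sin (2 * Real.pi * x) * Real.cos (2 * Real.pi * x))) /
      (1 + (2 * Real.pi * Real.sin (2 * Real.pi * x)) ^ 2) := by
    rw [← hN]
    field_simp
  rw [e]
  have hd : 1 + (2 * Real.pi * Real.sin (2 * Real.pi * x)) ^ 2 ≠ 0 := by positivity
  ext i
  fin_cases i
  · simp [cosNormal, cosSpeed]
    field_simp
    ring
  · simp [cosNormal, cosSpeed]
    field_simp
    ring

theorem hasDerivAt_cosPoint {x : ℝ → ℝ} {x' t : ℝ} (h : HasDerivAt x x' t) :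
    HasDerivAt (fun s => cosPoint (x s))
      (x' • !₂[1, -(2 * Real.pi * Real.sin (2 * Real.pi * x t))]) t := by
  rw [hasDerivAt_iff_hasFDerivAt, ← hasFDerivWithinAt_univ, hasFDerivWithinAt_euclidean]
  intro i
  rw [hasFDerivWithinAt_univ, hasFDerivAt_iff_hasDerivAt]
  fin_cases i
  · simpa [cosPoint] using h
  · have := (h.const_mul (2 * Real.pi)).cos
    simp only [cosPoint]
    simp
    refine this.congr_deriv (by ring)

/-! ### The boundary flow -/

/-- Global existence for an autonomous equation with bounded Lipschitz right-hand side. -/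
theorem exists_forall_hasDerivAt_of_lipschitz {E : Type*} [NormedAddCommGroup E] [NormedSpace ℝ E]
    [CompleteSpace E] {f : E → E} {K L : NNReal} (hf : LipschitzWith K f) (hL : ∀ x, ‖f x‖ ≤ L)
    (t₀ : ℝ) (x₀ : E) : ∃ α : ℝ → E, α t₀ = x₀ ∧ ∀ t, HasDerivAt α (f (α t)) t := by
  have loc : ∀ T : ℝ, ∃ α : ℝ → E, 0 < T →
      α t₀ = x₀ ∧ ∀ t ∈ Ioo (t₀ - T) (t₀ + T), HasDerivAt α (f (α t)) t := by
    intro T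
    by_cases hT : 0 < T
    swap
    · exact ⟨fun _ => 0, fun h => absurd h hT⟩
    -- The global bound `L` keeps the solution in the ball of radius `L T`, so `T` is arbitrary.
    have hP : IsPicardLindelof (fun _ => f) (tmin := t₀ - T) (tmax := t₀ + T)
        ⟨t₀, by constructor <;> linarith⟩ x₀ (L * T.toNNReal) 0 L K :=
      { lipschitzOnWith := fun _ _ => hf.lipschitzOnWith
        continuousOn := fun _ _ => continuousOn_const
        norm_le := fun _ _ x _ => hL x
        mul_max_le := by simp [hT.le] }
    obtain ⟨α, h1, h2⟩ := hP.exists_eq_forall_mem_Icc_hasDerivWithinAt₀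
    exact ⟨α, fun _ => ⟨h1, fun t ht => (h2 t (Ioo_subset_Icc_self ht)).hasDerivAt
      (Icc_mem_nhds ht.1 ht.2)⟩⟩
  choose α hα using loc
  have agree : ∀ S T : ℝ, 0 < S → S ≤ T → EqOn (α S) (α T) (Ioo (t₀ - S) (t₀ + S)) := by
    intro S T hS hST
    refine ODE_solution_unique_of_mem_Ioo (v := fun _ => f) (s := fun _ => univ) (K := K)
      (t₀ := t₀) (fun _ _ => hf.lipschitzOnWith) ⟨by linarith, by linarith⟩
      (fun t ht => ⟨(hα S hS).2 t ht, trivial⟩)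
      (fun t ht => ⟨(hα T (hS.trans_le hST)).2 t ⟨?_, ?_⟩, trivial⟩)
      ((hα S hS).1.trans (hα T (hS.trans_le hST)).1.symm)
    · linarith [ht.1]
    · linarith [ht.2]
  -- At time `t` the solution on the interval of radius `|t - t₀| + 1` is used; `agree` makes the
  -- pieces coincide.
  refine ⟨fun t => α (|t - t₀| + 1) t, ?_, fun t => ?_⟩
  · exact (hα _ (by positivity)).1
  have hpos : 0 < |t - t₀| + 1 := by positivity
  have mem : t ∈ Ioo (t₀ - (|t - t₀| + 1)) (t₀ + (|t - t₀| + 1)) := by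
    constructor
    · linarith [neg_abs_le (t - t₀)]
    · linarith [le_abs_self (t - t₀)]
  have hd := (hα (|t - t₀| + 1) hpos).2 t mem
  refine hd.congr_of_eventuallyEq ?_
  filter_upwards [Ioo_mem_nhds mem.1 mem.2] with s hs
  have hs' : s ∈ Ioo (t₀ - (|s - t₀| + 1)) (t₀ + (|s - t₀| + 1)) := by
    constructor
    · linarith [neg_abs_le (s - t₀)]
    · linarith [le_abs_self (s - t₀)]
  rcases le_total (|s - t₀| + 1) (|t - t₀| + 1) with h | h
  · exact agree _ _ (by positivity) h hs'
  · exact (agree _ _ hpos h hs).symm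

theorem contDiff_cosSpeed : ContDiff ℝ 1 cosSpeed := by
  unfold cosSpeed
  refine ContDiff.div (by fun_prop) (by fun_prop) fun x => by positivity

theorem cosSpeed_denom_pos (x : ℝ) :
    0 < 1 + (2 * Real.pi * Real.sin (2 * Real.pi * x)) ^ 2 := by positivity

/-- On each hill, slightly to the right of the top, there is an equilibrium. -/
theorem exists_cosSpeed_eq_zero {N : ℕ} (hN : 1 ≤ N) :
    ∃ p : ℝ, p ∈ Icc (N : ℝ) (N + 1 / 12) ∧ cosSpeed p = 0 := by
  have hN' : (1 : ℝ) ≤ N := by exact_mod_cast hN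
  have hpi := Real.pi_gt_three
  have e0 : 2 * Real.pi * (N : ℝ) = 0 + N * (2 * Real.pi) := by ring
  have e1 : 2 * Real.pi * ((N : ℝ) + 1 / 12) = Real.pi / 6 + N * (2 * Real.pi) := by ring
  have h := intermediate_value_Icc (f := cosSpeed) (a := (N : ℝ)) (b := N + 1 / 12) (by linarith)
    contDiff_cosSpeed.continuous.continuousOn
  -- The numerator is `-1` at `N` and `π x - √3 / 2 > 0` at `x = N + 1/12`.
  refine (h ⟨?_, ?_⟩)
  · refine div_nonpos_of_nonpos_of_nonneg ?_ (cosSpeed_denom_pos _).le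
    rw [e0, Real.cos_add_nat_mul_two_pi, Real.sin_add_nat_mul_two_pi]
    simp
  · refine div_nonneg ?_ (cosSpeed_denom_pos _).le
    rw [e1, Real.cos_add_nat_mul_two_pi, Real.sin_add_nat_mul_two_pi, Real.cos_pi_div_six,
      Real.sin_pi_div_six]
    nlinarith [Real.cos_pi_div_six, Real.cos_le_one (Real.pi / 6), Real.pi_pos]

/-- The equilibrium on a hill is strongly repelling. -/
theorem lt_cosSpeed {N : ℕ} (hN : 1 ≤ N) {p x : ℝ} (hp : (N : ℝ) ≤ p) (h0 : cosSpeed p = 0)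
    (hpx : p < x) (hx : x ≤ N + 1 / 6) : N / 2 * (x - p) < cosSpeed x := by
  have hN' : (1 : ℝ) ≤ N := by exact_mod_cast hN
  have hpi := Real.pi_gt_three
  set H : ℝ → ℝ := fun x =>
    2 * Real.pi * x * Real.sin (2 * Real.pi * x) - Real.cos (2 * Real.pi * x) with hH
  have hd : ∀ y, HasDerivAt H (4 * Real.pi * Real.sin (2 * Real.pi * y) +
      4 * Real.pi ^ 2 * y * Real.cos (2 * Real.pi * y)) y := by
    intro y
    have h1 : HasDerivAt (fun y : ℝ => 2 * Real.pi * y) (2 * Real.pi) y := by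
      simpa using (hasDerivAt_id y).const_mul (2 * Real.pi)
    refine ((h1.mul h1.sin).sub h1.cos).congr_deriv ?_
    ring
  -- The width `1/6` keeps the angle, measured from the hilltop, below `π / 3`.
  have trig : ∀ y ∈ Icc (N : ℝ) (N + 1 / 6),
      0 ≤ Real.sin (2 * Real.pi * y) ∧ 1 / 2 ≤ Real.cos (2 * Real.pi * y) := by
    intro y hy
    have e : 2 * Real.pi * y = 2 * Real.pi * (y - N) + N * (2 * Real.pi) := by ring
    rw [e, Real.sin_add_nat_mul_two_pi, Real.cos_add_nat_mul_two_pi]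
    have a1 : 0 ≤ 2 * Real.pi * (y - N) := by
      have := hy.1
      exact mul_nonneg (by positivity) (by linarith)
    have a2 : 2 * Real.pi * (y - N) ≤ Real.pi / 3 := by nlinarith [hy.2]
    refine ⟨Real.sin_nonneg_of_nonneg_of_le_pi a1 (by linarith), ?_⟩
    rw [← Real.cos_pi_div_three]
    exact Real.cos_le_cos_of_nonneg_of_le_pi a1 (by linarith) a2
  have hp0 : H p = 0 := by
    rcases div_eq_zero_iff.1 h0 with h | h
    · exact h
    · exact absurd h (cosSpeed_denom_pos p).ne'
  have hm := (convex_Icc (N : ℝ) (N + 1 / 6)).mul_sub_le_image_sub_of_le_deriv (f := H)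
    (fun y _ => (hd y).continuousAt.continuousWithinAt)
    (fun y _ => (hd y).differentiableAt.differentiableWithinAt) (C := 2 * Real.pi ^ 2 * N)
    (fun y hy => by
      have hy := interior_subset hy
      obtain ⟨h1, h2⟩ := trig y hy
      rw [(hd y).deriv]
      have b1 : (N : ℝ) * (1 / 2) ≤ y * Real.cos (2 * Real.pi * y) :=
        mul_le_mul hy.1 h2 (by norm_num) (by linarith [hy.1])
      have b2 : 0 ≤ 4 * Real.pi * Real.sin (2 * Real.pi * y) := by positivity
      nlinarith [mul_le_mul_of_nonneg_left b1 (by positivity : 0 ≤ 4 * Real.pi ^ 2)])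
    p ⟨hp, by linarith⟩ x ⟨by linarith, hx⟩ hpx.le
  rw [hp0, sub_zero] at hm
  obtain ⟨-, hc⟩ := trig x ⟨by linarith, hx⟩
  rw [cosSpeed, lt_div_iff₀ (cosSpeed_denom_pos x)]
  -- The denominator is at most `1 + 3π² < 4π²`; against the slope `2π² N` of the numerator this
  -- leaves the rate `N / 2`.
  have hden : 1 + (2 * Real.pi * Real.sin (2 * Real.pi * x)) ^ 2 < 4 * Real.pi ^ 2 := by
    have := Real.sin_sq_add_cos_sq (2 * Real.pi * x)
    have hs : Real.sin (2 * Real.pi * x) ^ 2 ≤ 3 / 4 := by nlinarith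
    nlinarith [mul_le_mul_of_nonneg_left hs (by positivity : 0 ≤ 4 * Real.pi ^ 2)]
  calc N / 2 * (x - p) * (1 + (2 * Real.pi * Real.sin (2 * Real.pi * x)) ^ 2)
      < N / 2 * (x - p) * (4 * Real.pi ^ 2) := by
        have : 0 < N / 2 * (x - p) := mul_pos (by linarith) (by linarith)
        exact mul_lt_mul_of_pos_left hden this
    _ = 2 * Real.pi ^ 2 * N * (x - p) := by ring
    _ ≤ _ := hm

/-- A trajectory between two consecutive hill equilibria that reaches `N + 1 / 6` at time `t₀` and
starts exponentially close to the left equilibrium. -/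
theorem exists_trajectory {N : ℕ} (hN : 1 ≤ N) {p p' : ℝ} (hp : p ∈ Icc (N : ℝ) (N + 1 / 12))
    (hp0 : cosSpeed p = 0) (hp' : (N : ℝ) + 1 ≤ p') (hp0' : cosSpeed p' = 0) {t₀ : ℝ}
    (ht₀ : 0 < t₀) :
    ∃ x : ℝ → ℝ, x t₀ = N + 1 / 6 ∧ (∀ t, HasDerivAt x (cosSpeed (x t)) t) ∧
      (∀ t, x t ∈ Ioo p p') ∧ x 0 ≤ N + 1 / 6 ∧ x 0 - p ≤ Real.exp (-(N / 2 * t₀)) := by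
  have hN' : (1 : ℝ) ≤ N := by exact_mod_cast hN
  obtain ⟨hp1, hp2⟩ := hp
  have hpp : p ≤ p' := by linarith
  obtain ⟨K, hK⟩ := (contDiff_cosSpeed.contDiffOn (s := Icc p p')).exists_lipschitzOnWith
    one_ne_zero (convex_Icc _ _) isCompact_Icc
  obtain ⟨L, hL⟩ := (isCompact_Icc (a := p) (b := p')).exists_bound_of_continuousOn
    contDiff_cosSpeed.continuous.continuousOn
  -- Clamping to `[p, p']` makes the field globally Lipschitz and bounded. The solution never
  -- reaches the endpoints, by uniqueness against the constant solutions, so the clamping is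
  -- invisible to it.
  set f : ℝ → ℝ := fun y => cosSpeed (projIcc p p' hpp y) with hf
  have hfL : LipschitzWith (K * 1) f := hK.to_restrict.comp (LipschitzWith.projIcc hpp)
  have hfeq : ∀ y ∈ Icc p p', f y = cosSpeed y := by
    intro y hy
    simp [hf, projIcc_of_mem hpp hy]
  obtain ⟨x, hx0, hx⟩ := exists_forall_hasDerivAt_of_lipschitz (L := L.toNNReal) hfL
    (fun y => (hL _ (projIcc p p' hpp y).2).trans (Real.le_coe_toNNReal L)) t₀ ((N : ℝ) + 1 / 6)
  have hcont : Continuous x := continuous_iff_continuousAt.2 fun t => (hx t).continuousAt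
  have avoid : ∀ q, f q = 0 → q ≠ N + 1 / 6 → ∀ t, x t ≠ q := by
    intro q hq hne t ht
    have : x = fun _ => q := ODE_solution_unique_univ (v := fun _ => f) (s := fun _ => univ)
      (K := K * 1) (t₀ := t) (fun _ => hfL.lipschitzOnWith) (fun t => ⟨hx t, trivial⟩)
      (fun t => ⟨by rw [hq]; exact hasDerivAt_const t q, trivial⟩) ht
    rw [this] at hx0
    exact hne hx0
  have hav := avoid p (by rw [hfeq p ⟨le_rfl, hpp⟩, hp0]) (by linarith)
  have hav' := avoid p' (by rw [hfeq p' ⟨hpp, le_rfl⟩, hp0']) (by linarith)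
  have hmem : ∀ t, x t ∈ Ioo p p' := by
    intro t
    constructor
    · by_contra! h
      obtain ⟨s, hs⟩ := mem_range_of_exists_le_of_exists_ge hcont ⟨t, h⟩
        ⟨t₀, by rw [hx0]; linarith⟩
      exact hav s hs
    · by_contra! h
      obtain ⟨s, hs⟩ := mem_range_of_exists_le_of_exists_ge hcont
        ⟨t₀, by rw [hx0]; linarith⟩ ⟨t, h⟩
      exact hav' s hs
  have hx' : ∀ t, HasDerivAt x (cosSpeed (x t)) t := fun t => by
    rw [← hfeq _ (Ioo_subset_Icc_self (hmem t))]
    exact hx t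
  -- Barrier for the time-reversed solution: exact exponential decay to `p` at rate `N / 2`. The
  -- strict inequality in `lt_cosSpeed` is what the comparison requires at a contact point.
  set B : ℝ → ℝ := fun s => p + (N + 1 / 6 - p) * Real.exp (-(N / 2 * s)) with hB
  have hBd : ∀ s, HasDerivAt B (-(N / 2 * (B s - p))) s := by
    intro s
    have h1 : HasDerivAt (fun s : ℝ => -((N : ℝ) / 2 * s)) (-(N / 2)) s := by
      simpa using ((hasDerivAt_id s).const_mul ((N : ℝ) / 2)).fun_neg
    refine ((h1.exp.const_mul ((N : ℝ) + 1 / 6 - p)).const_add p).congr_deriv ?_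
    simp only [hB]
    ring
  have hrev : ∀ s, HasDerivAt (fun s => x (t₀ - s)) (-cosSpeed (x (t₀ - s))) s := by
    intro s
    have h1 : HasDerivAt (fun s : ℝ => t₀ - s) (-1) s := by
      simpa using (hasDerivAt_id s).const_sub t₀
    exact ((hx' (t₀ - s)).comp s h1).congr_deriv (by ring)
  have hBle : ∀ s, 0 ≤ s → B s ≤ N + 1 / 6 := by
    intro s hs
    have : Real.exp (-((N : ℝ) / 2 * s)) ≤ 1 := by
      rw [Real.exp_le_one_iff]
      have : 0 ≤ (N : ℝ) / 2 * s := by positivity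
      linarith
    simp only [hB]
    nlinarith
  have key := image_le_of_deriv_right_lt_deriv_boundary (f := fun s => x (t₀ - s)) (a := 0)
    (b := t₀) (fun s _ => (hrev s).continuousAt.continuousWithinAt)
    (fun s _ => (hrev s).hasDerivWithinAt) (B := B) (by simp [hB, hx0]) hBd
    (fun s hs he => by
      have := lt_cosSpeed hN hp1 hp0 (hmem (t₀ - s)).1 (by rw [he]; exact hBle s hs.1)
      rw [he] at this
      simp only [he]
      linarith) (right_mem_Icc.2 ht₀.le)
  simp only [sub_self] at key
  refine ⟨x, hx0, hx', hmem, key.trans (hBle t₀ ht₀.le), ?_⟩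
  simp only [hB] at key
  nlinarith [Real.exp_pos (-((N : ℝ) / 2 * t₀))]

/-! ### Estimates of the Wasserstein distance -/

/-- Leave `ν` in place on the diagonal and send the atom from `x` to `y`. -/
theorem dW_add_dirac_le {d : ℕ} (ν : Measure (Rd d)) (m : ℝ≥0∞) (x y : Rd d) :
    dW (ν + m • Measure.dirac x) (ν + m • Measure.dirac y) ≤ m ^ (1 / 2 : ℝ) * edist x y := by
  have hdiag : Measurable fun z : Rd d => (z, z) := by fun_prop
  have hmem : ν.map (fun z => (z, z)) + m • Measure.dirac (x, y) ∈
      plans (ν + m • Measure.dirac x) (ν + m • Measure.dirac y) := by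
    constructor
    · rw [Measure.fst, Measure.map_add _ _ measurable_fst, Measure.map_smul,
        Measure.map_map measurable_fst hdiag, Measure.map_dirac]
      simp [Function.comp_def]
    · rw [Measure.snd, Measure.map_add _ _ measurable_snd, Measure.map_smul,
        Measure.map_map measurable_snd hdiag, Measure.map_dirac]
      simp [Function.comp_def]
  have hcost : ∫⁻ z, edist z.1 z.2 ^ 2 ∂(ν.map (fun z => (z, z)) + m • Measure.dirac (x, y))
      = m * edist x y ^ 2 := by
    rw [lintegral_add_measure, lintegral_smul_measure, lintegral_dirac,
      lintegral_map (by fun_prop) hdiag]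
    simp
  have h : (⨅ γ ∈ plans (ν + m • Measure.dirac x) (ν + m • Measure.dirac y),
      ∫⁻ z, edist z.1 z.2 ^ 2 ∂γ) ≤ m * edist x y ^ 2 := (iInf₂_le _ hmem).trans_eq hcost
  refine (ENNReal.rpow_le_rpow h (by norm_num : (0 : ℝ) ≤ 1 / 2)).trans_eq ?_
  rw [ENNReal.mul_rpow_of_nonneg _ _ (by norm_num), ← ENNReal.rpow_natCast, ← ENNReal.rpow_mul]
  norm_num

/-- Every plan brings at least the mass `m` to `q`, and all of it travels at least `r`. -/
theorem le_dW_of_atom {d : ℕ} {μ ν : Measure (Rd d)} {q : Rd d} {m r : ℝ≥0∞} (hm : m ≤ ν {q})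
    (hr : ∀ᵐ x ∂μ, r ≤ edist x q) : m ^ (1 / 2 : ℝ) * r ≤ dW μ ν := by
  have h : m * r ^ 2 ≤ ⨅ γ ∈ plans μ ν, ∫⁻ z, edist z.1 z.2 ^ 2 ∂γ := by
    refine le_iInf₂ fun γ hγ => ?_
    obtain ⟨rfl, rfl⟩ := hγ
    have hs : MeasurableSet (Prod.snd ⁻¹' {q} : Set (Rd d × Rd d)) :=
      measurable_snd (measurableSet_singleton q)
    have hr' : ∀ᵐ z ∂γ, r ≤ edist z.1 q := ae_of_ae_map measurable_fst.aemeasurable hr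
    calc m * r ^ 2 ≤ r ^ 2 * γ (Prod.snd ⁻¹' {q}) := by
          rw [mul_comm]
          gcongr
          rwa [Measure.snd_apply (measurableSet_singleton q)] at hm
      _ = ∫⁻ _ in Prod.snd ⁻¹' {q}, r ^ 2 ∂γ := by rw [setLIntegral_const]
      _ ≤ ∫⁻ z in Prod.snd ⁻¹' {q}, edist z.1 z.2 ^ 2 ∂γ := by
          refine lintegral_mono_ae ?_
          filter_upwards [ae_restrict_of_ae hr', ae_restrict_mem hs] with z hz hzq
          rw [show z.2 = q from hzq]
          gcongr
      _ ≤ _ := setLIntegral_le_lintegral _ _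
  refine le_trans (le_of_eq ?_) (ENNReal.rpow_le_rpow h (by norm_num : (0 : ℝ) ≤ 1 / 2))
  rw [ENNReal.mul_rpow_of_nonneg _ _ (by norm_num), ← ENNReal.rpow_natCast, ← ENNReal.rpow_mul]
  norm_num

/-! ### Solutions with one moving atom -/

/-- If the velocity field does not depend on the measure and vanishes `ν`-almost everywhere, then
`ν` plus an atom that follows the velocity field is a weak solution. -/
theorem isGlobalWeakSolution_add_dirac {d : ℕ} {Ω : Set (Rd d)} {V W : Rd d → ℝ} {u : Rd d → Rd d}
    (hu : ∀ μ x, velocity Ω V W μ x = u x) {ν : Measure (Rd d)} {m : ℝ≥0∞}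
    (hprob : ν univ + m = 1) (hνΩ : ν (closure Ω)ᶜ = 0) (hν2 : ∫⁻ x, ‖x‖ₑ ^ 2 ∂ν < ⊤)
    (hνu : ∀ᵐ x ∂ν, u x = 0) {X : ℝ → Rd d} (hX : ∀ t, HasDerivAt X (u (X t)) t)
    (huX : Continuous fun t => u (X t)) (hXΩ : ∀ t, X t ∈ closure Ω) :
    IsGlobalWeakSolution Ω V W (ν + m • Measure.dirac (X 0))
      (fun t => ν + m • Measure.dirac (X t)) := by
  intro T hT
  have hm1 : m ≤ 1 := hprob ▸ le_add_self
  have hmtop : m ≠ ⊤ := ne_top_of_le_ne_top ENNReal.one_ne_top hm1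
  have hνfin : IsFiniteMeasure ν :=
    ⟨lt_of_le_of_lt (hprob ▸ le_self_add : ν univ ≤ 1) ENNReal.one_lt_top⟩
  have hXc : Continuous X := continuous_iff_continuousAt.2 fun t => (hX t).continuousAt
  have hvel : ∀ μ, velocity Ω V W μ = u := fun μ => funext (hu μ)
  have hnorm : ∀ t, eLpNorm u 2 (ν + m • Measure.dirac (X t)) =
      m ^ (1 / 2 : ℝ) * ‖u (X t)‖ₑ := by
    intro t
    rw [eLpNorm_eq_lintegral_rpow_enorm_toReal (by norm_num) (by norm_num), lintegral_add_measure,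
      lintegral_smul_measure, lintegral_dirac]
    have : ∫⁻ x, ‖u x‖ₑ ^ (2 : ℝ≥0∞).toReal ∂ν = 0 := by
      rw [lintegral_congr_ae (g := fun _ => 0), lintegral_zero]
      filter_upwards [hνu] with x hx
      simp [hx]
    rw [this, zero_add, smul_eq_mul, ENNReal.mul_rpow_of_nonneg _ _ (by norm_num),
      ← ENNReal.rpow_mul]
    norm_num
  refine ⟨rfl, ?_, ?_, ?_, ?_, ?_⟩
  · intro t _
    refine ⟨⟨?_⟩, ?_, ?_⟩
    · simpa using hprob
    · simp [hνΩ, hXΩ t]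
    · rw [lintegral_add_measure, lintegral_smul_measure, lintegral_dirac]
      exact ENNReal.add_lt_top.2 ⟨hν2, ENNReal.mul_lt_top hmtop.lt_top (by simp)⟩
  · refine ⟨fun r => ‖u (X r)‖, huX.norm.continuousOn.integrableOn_Icc, fun s t _ hst _ => ?_⟩
    have hsub : ∫ r in s..t, u (X r) = X t - X s :=
      intervalIntegral.integral_eq_sub_of_hasDerivAt (fun r _ => hX r)
        (huX.intervalIntegrable _ _)
    calc dW (ν + m • Measure.dirac (X s)) (ν + m • Measure.dirac (X t))
        ≤ m ^ (1 / 2 : ℝ) * edist (X s) (X t) := dW_add_dirac_le _ _ _ _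
      _ ≤ 1 * edist (X s) (X t) := by
          gcongr
          exact ENNReal.rpow_le_one hm1 (by norm_num)
      _ = ENNReal.ofReal (dist (X s) (X t)) := by rw [one_mul, edist_dist]
      _ ≤ _ := by
          refine ENNReal.ofReal_le_ofReal ?_
          rw [dist_comm, dist_eq_norm, ← hsub]
          exact intervalIntegral.norm_integral_le_integral_norm hst
  · refine Eventually.of_forall fun t _ => ?_
    rw [hvel]
    -- No measurability of `u` is assumed: it is `ν`-a.e. zero, and any function is a.e. strongly
    -- measurable for a Dirac mass.
    refine ⟨AEStronglyMeasurable.add_measure ?_ ?_, ?_⟩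
    · exact aestronglyMeasurable_const.congr (Filter.EventuallyEq.symm hνu)
    · exact aestronglyMeasurable_dirac.smul_measure m
    · rw [hnorm]
      exact ENNReal.mul_lt_top (ENNReal.rpow_lt_top_of_nonneg (by norm_num) hmtop) (by simp)
  · intro T' _
    simp only [hvel, hnorm, ENNReal.toReal_mul, toReal_enorm]
    exact (continuous_const.mul huX.norm).continuousOn.integrableOn_Icc
  · intro φ hφ hφc hφs
    simp only [hvel]
    have hφd : ∀ q, HasFDerivAt φ (fderiv ℝ φ q) q := fun q =>
      (hφ.differentiable (by simp) q).hasFDerivAt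
    have hφ' : Continuous (fderiv ℝ φ) := hφ.continuous_fderiv (by simp)
    have hzero : ∀ x t, t ∉ Ioo 0 T → φ (x, t) = 0 := by
      intro x t ht
      refine image_eq_zero_of_notMem_tsupport fun h => ht (hφs h).2
    have htime : ∀ x t, HasDerivAt (fun s => φ (x, s)) (fderiv ℝ φ (x, t) (0, 1)) t := by
      intro x t
      exact (hφd (x, t)).comp_hasDerivAt t ((hasDerivAt_const t x).prodMk (hasDerivAt_id t))
    have hspace : ∀ x t v, inner ℝ (gradient (fun y => φ (y, t)) x) v
        = fderiv ℝ φ (x, t) (v, 0) := by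
      intro x t v
      have h1 : HasFDerivAt (fun y => φ (y, t))
          ((fderiv ℝ φ (x, t)).comp (ContinuousLinearMap.inl ℝ (Rd d) ℝ)) x :=
        (hφd (x, t)).comp x (hasFDerivAt_prodMk_left x t)
      rw [inner_gradient_left, h1.fderiv]
      simp
    set D : Rd d × ℝ → ℝ := fun q => fderiv ℝ φ q (0, 1) with hD
    have hDc : Continuous D := hφ'.clm_apply continuous_const
    have hDs : HasCompactSupport D := 
      (hφc.fderiv ℝ).comp_left (g := fun L : Rd d × ℝ →L[ℝ] ℝ => L (0, 1)) (by simp)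
    have hDint : ∀ t, Integrable (fun x => D (x, t)) ν := by
      intro t
      obtain ⟨C, hC⟩ := hDs.exists_bound_of_continuous hDc
      exact Integrable.of_bound (by fun_prop) C (Eventually.of_forall fun x => hC (x, t))
    have hprod : Integrable (Function.uncurry fun (t : ℝ) (x : Rd d) => D (x, t))
        ((volume.restrict (Ioo 0 T)).prod ν) := by
      obtain ⟨C, hC⟩ := hDs.exists_bound_of_continuous hDc
      have : Continuous (Function.uncurry fun (t : ℝ) (x : Rd d) => D (x, t)) := by
        unfold Function.uncurry
        fun_prop
      exact Integrable.of_bound this.aestronglyMeasurable C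
        (Eventually.of_forall fun q => hC (q.2, q.1))
    -- On the atom the two terms of the equation combine to the total derivative of `φ` along the
    -- trajectory.
    set g : ℝ → ℝ := fun t => fderiv ℝ φ (X t, t) (u (X t), 1) with hg
    have hgc : Continuous g := by
      simp only [hg]
      exact (hφ'.comp (hXc.prodMk continuous_id)).clm_apply (huX.prodMk continuous_const)
    have hgd : ∀ t, HasDerivAt (fun s => φ (X s, s)) (g t) t := fun t =>
      (hφd (X t, t)).comp_hasDerivAt (f := fun s => (X s, s)) t ((hX t).prodMk (hasDerivAt_id t))
    have hinner : ∀ t, ∫ x, (deriv (fun s => φ (x, s)) t +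
        inner ℝ (gradient (fun y => φ (y, t)) x) (u x)) ∂(ν + m • Measure.dirac (X t))
        = ∫ x, D (x, t) ∂ν + m.toReal * g t := by
      intro t
      simp only [hspace, (htime _ t).deriv]
      have hae : (fun x => fderiv ℝ φ (x, t) (0, 1) + fderiv ℝ φ (x, t) (u x, 0))
          =ᵐ[ν] fun x => D (x, t) := by
        filter_upwards [hνu] with x hx
        rw [hx, Prod.mk_zero_zero, map_zero, add_zero]
      rw [integral_add_measure ((hDint t).congr hae.symm)
        ((integrable_dirac (by simp)).smul_measure hmtop), integral_congr_ae hae,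
        integral_smul_measure, integral_dirac, smul_eq_mul, ← map_add]
      simp [hg]
    simp only [hinner]
    -- Test functions vanish at times `0` and `T`. This is applied along the trajectory and, after
    -- Fubini, at each fixed `x` for the resting part.
    have hFTC : ∀ (F F' : ℝ → ℝ), Continuous F' → (∀ t, HasDerivAt F (F' t) t) → F 0 = 0 →
        F T = 0 → ∫ t in Ioo 0 T, F' t = 0 := by
      intro F F' hc hd h0 hT0
      rw [← integral_Ioc_eq_integral_Ioo, ← intervalIntegral.integral_of_le hT.le,
        intervalIntegral.integral_eq_sub_of_hasDerivAt (fun t _ => hd t)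
          (hc.intervalIntegrable _ _), h0, hT0, sub_zero]
    have hA : Integrable (fun t => ∫ x, D (x, t) ∂ν) (volume.restrict (Ioo 0 T)) :=
      hprod.integral_prod_left
    have hB : Integrable (fun t => m.toReal * g t) (volume.restrict (Ioo 0 T)) :=
      (hgc.continuousOn.integrableOn_Icc.mono_set Ioo_subset_Icc_self).const_mul _
    rw [integral_add hA hB, integral_const_mul,
      hFTC _ g hgc hgd (hzero _ _ (by simp)) (hzero _ _ (by simp)), mul_zero, add_zero,
      integral_integral_swap hprod]
    refine integral_eq_zero_of_ae (Eventually.of_forall fun x => ?_)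
    exact hFTC (fun t => φ (x, t)) _ (hDc.comp (Continuous.prodMk_right x)) (htime x)
      (hzero _ _ (by simp)) (hzero _ _ (by simp))

/-! ### Decay at infinity -/

/-- For `‖x‖ ≥ R`, `exp (c R) ≤ exp (2 c ‖x‖) exp (-c R)`: the doubled exponent leaves a decaying
factor. -/
theorem conditionRWith_of_lintegral {d : ℕ} {μ : Measure (Rd d)} {c : ℝ} (hc : 0 < c)
    (h : ∫⁻ x, ‖x‖ₑ ^ 2 * ENNReal.ofReal (Real.exp (2 * c * ‖x‖)) ∂μ < ⊤) :
    ConditionRWith c μ := by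
  set I := ∫⁻ x, ‖x‖ₑ ^ 2 * ENNReal.ofReal (Real.exp (2 * c * ‖x‖)) ∂μ
  have hlim : Tendsto (fun R : ℝ => I * ENNReal.ofReal (Real.exp (-(c * R)))) atTop (𝓝 0) := by
    have h1 : Tendsto (fun R : ℝ => Real.exp (-(c * R))) atTop (𝓝 0) :=
      Real.tendsto_exp_neg_atTop_nhds_zero.comp (tendsto_id.const_mul_atTop hc)
    have h2 := ENNReal.tendsto_ofReal h1
    rw [ENNReal.ofReal_zero] at h2
    simpa using ENNReal.Tendsto.const_mul h2 (Or.inr h.ne)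
  refine tendsto_of_tendsto_of_tendsto_of_le_of_le tendsto_const_nhds hlim
    (fun R => zero_le) fun R => ?_
  simp only [tail]
  rw [← lintegral_mul_const _ (by fun_prop), ← lintegral_mul_const _ (by fun_prop)]
  refine le_trans (setLIntegral_mono (by fun_prop) fun x hx => ?_) (setLIntegral_le_lintegral _ _)
  have hx' : R ≤ ‖x‖ := by simpa using hx
  rw [mul_assoc, ← ENNReal.ofReal_mul (Real.exp_pos _).le, ← Real.exp_add]
  gcongr
  nlinarith

theorem polynomialDecayWith_of_lintegral {d : ℕ} {μ : Measure (Rd d)} {C : ℝ}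
    (h : ∫⁻ x, ‖x‖ₑ ^ 3 ∂μ ≤ ENNReal.ofReal C) : PolynomialDecayWith C 1 μ := by
  intro R hR
  have hR0 : 0 < R := by linarith
  rw [Real.rpow_neg_one, ENNReal.ofReal_mul' (by positivity), tail]
  refine le_trans ?_ (mul_le_mul_left h _)
  rw [← lintegral_mul_const _ (by fun_prop)]
  refine le_trans (setLIntegral_mono (by fun_prop) fun x hx => ?_) (setLIntegral_le_lintegral _ _)
  have hx' : R ≤ ‖x‖ := by simpa using hx
  rw [pow_succ _ 2, mul_assoc, ← ofReal_norm, ← ENNReal.ofReal_mul (norm_nonneg x)]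
  refine le_mul_of_one_le_right (zero_le) ?_
  rw [ENNReal.one_le_ofReal, ← div_eq_mul_inv, one_le_div hR0]
  exact hx'

/-- At radius `R = k ≥ 1` the atom at `z k` alone contributes at least `w k` to the tail. -/
theorem not_conditionR_of_atoms {d : ℕ} {μ : Measure (Rd d)} {w : ℕ → ℝ} {z : ℕ → Rd d}
    (hz : ∀ k : ℕ, (k : ℝ) ≤ ‖z k‖) (hμ : ∀ᶠ k in atTop, ENNReal.ofReal (w k) ≤ μ {z k})
    (hw : ∀ c > 0, Tendsto (fun k : ℕ => w k * Real.exp (c * k)) atTop atTop) :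
    ¬ ConditionR μ := by
  rintro ⟨c, hc, h⟩
  have h1 := (h.comp (tendsto_natCast_atTop_atTop (R := ℝ))).eventually
    (gt_mem_nhds (zero_lt_one : (0 : ℝ≥0∞) < 1))
  obtain ⟨k, hk, hμk, hwk, hk1⟩ := (h1.and (hμ.and (((hw c hc).eventually_ge_atTop 1).and
    (eventually_ge_atTop 1)))).exists
  refine absurd hk (not_lt.2 ?_)
  have hk1' : (1 : ℝ) ≤ k := by exact_mod_cast hk1
  have hsub : {z k} ⊆ (Metric.ball (0 : Rd d) k)ᶜ := by
    rintro _ rfl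
    simpa using hz k
  simp only [Function.comp_apply]
  calc (1 : ℝ≥0∞) ≤ ENNReal.ofReal (w k * Real.exp (c * k)) := by
        rwa [ENNReal.one_le_ofReal]
    _ = ENNReal.ofReal (w k) * ENNReal.ofReal (Real.exp (c * k)) :=
        ENNReal.ofReal_mul' (Real.exp_pos _).le
    _ ≤ tail k μ * ENNReal.ofReal (Real.exp (c * k)) := by
        gcongr
        calc ENNReal.ofReal (w k) ≤ μ {z k} := hμk
          _ ≤ ‖z k‖ₑ ^ 2 * μ {z k} := by
              refine le_mul_of_one_le_left (zero_le) (one_le_pow₀ ?_)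
              rw [← ofReal_norm, ENNReal.one_le_ofReal]
              exact hk1'.trans (hz k)
          _ = ∫⁻ x in {z k}, ‖x‖ₑ ^ 2 ∂μ := by
              rw [lintegral_singleton]
          _ ≤ tail k μ := lintegral_mono_set hsub

/-! ### Atomic measures -/

/-- The measure with the mass `w k` at the point `z k`. -/
noncomputable def atomic {d : ℕ} (w : ℕ → ℝ) (z : ℕ → Rd d) : Measure (Rd d) :=
  Measure.sum fun k => ENNReal.ofReal (w k) • Measure.dirac (z k)

/-- The measure with the mass `w k` at the point `z k` for `k ≠ n`. -/
noncomputable def atomicErase {d : ℕ} (w : ℕ → ℝ) (z : ℕ → Rd d) (n : ℕ) : Measure (Rd d) :=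
  Measure.sum fun k => if k = n then 0 else ENNReal.ofReal (w k) • Measure.dirac (z k)

theorem atomic_update {d : ℕ} (w : ℕ → ℝ) (z : ℕ → Rd d) (n : ℕ) (x : Rd d) :
    atomic w (Function.update z n x) =
      atomicErase w z n + ENNReal.ofReal (w n) • Measure.dirac x := by
  ext s hs
  rw [atomic, atomicErase, Measure.add_apply, Measure.sum_apply _ hs, Measure.sum_apply _ hs,
    ENNReal.tsum_eq_add_tsum_ite n, add_comm]
  congr 1
  · refine tsum_congr fun k => ?_
    split_ifs with h
    · simp
    · rw [Function.update_of_ne h]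
  · simp

theorem lintegral_atomic {d : ℕ} (w : ℕ → ℝ) (z : ℕ → Rd d) (f : Rd d → ℝ≥0∞) :
    ∫⁻ x, f x ∂(atomic w z) = ∑' k, ENNReal.ofReal (w k) * f (z k) := by
  simp [atomic, lintegral_sum_measure]

theorem ae_atomic {d : ℕ} (w : ℕ → ℝ) {z : ℕ → Rd d} {P : Rd d → Prop} (h : ∀ k, P (z k)) :
    ∀ᵐ x ∂(atomic w z), P x := by
  rw [atomic, Measure.ae_sum_iff]
  refine fun k => Measure.ae_smul_measure ?_ _
  simp [ae_dirac_eq, h k]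

theorem atomicErase_le {d : ℕ} (w : ℕ → ℝ) (z : ℕ → Rd d) (n : ℕ) :
    atomicErase w z n ≤ atomic w z := by
  have h := atomic_update w z n (z n)
  rw [Function.update_eq_self] at h
  rw [h]
  exact Measure.le_add_right le_rfl

theorem ofReal_le_atomic {d : ℕ} (w : ℕ → ℝ) (z : ℕ → Rd d) (k : ℕ) :
    ENNReal.ofReal (w k) ≤ atomic w z {z k} := by
  refine le_trans ?_ (Measure.le_sum_apply _ _ |>.trans' (ENNReal.le_tsum k))
  simp

theorem lintegral_atomic_le {d : ℕ} {w : ℕ → ℝ} {z : ℕ → Rd d} {f : Rd d → ℝ≥0∞} {F : ℕ → ℝ}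
    (hw : ∀ k, 0 ≤ w k) (hF : ∀ k, 0 ≤ F k) (hs : Summable fun k => w k * F k)
    (h : ∀ k, f (z k) ≤ ENNReal.ofReal (F k)) :
    ∫⁻ x, f x ∂(atomic w z) ≤ ENNReal.ofReal (∑' k, w k * F k) := by
  rw [lintegral_atomic, ENNReal.ofReal_tsum_of_nonneg (fun k => mul_nonneg (hw k) (hF k)) hs]
  refine ENNReal.tsum_le_tsum fun k => ?_
  rw [ENNReal.ofReal_mul (hw k)]
  gcongr
  exact h k

theorem atomic_univ {d : ℕ} {w : ℕ → ℝ} (hw : ∀ k, 0 ≤ w k) (h1 : HasSum w 1) (z : ℕ → Rd d) :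
    atomic w z univ = 1 := by
  rw [atomic, Measure.sum_apply _ MeasurableSet.univ]
  simp [← ENNReal.ofReal_tsum_of_nonneg hw h1.summable, h1.tsum_eq]

/-! ### The perturbed atomic solutions -/

theorem abs_le_norm_cosPoint (x : ℝ) : |x| ≤ ‖cosPoint x‖ := by
  simpa [cosPoint] using PiLp.norm_apply_le (cosPoint x) 0

theorem norm_cosPoint_le (x : ℝ) : ‖cosPoint x‖ ≤ |x| + 1 := by
  refine abs_le_of_sq_le_sq' ?_ (by positivity) |>.2
  have h : ‖cosPoint x‖ ^ 2 = x ^ 2 + Real.cos (2 * Real.pi * x) ^ 2 := by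
    simp [EuclideanSpace.norm_sq_eq, cosPoint, Fin.sum_univ_two]
  rw [h, add_sq, sq_abs]
  nlinarith [Real.cos_sq_le_one (2 * Real.pi * x), abs_nonneg x]

theorem ofReal_abs_sub_le_edist_cosPoint (x y : ℝ) :
    ENNReal.ofReal |x - y| ≤ edist (cosPoint x) (cosPoint y) := by
  rw [edist_dist, dist_eq_norm]
  refine ENNReal.ofReal_le_ofReal ?_
  simpa [cosPoint] using PiLp.norm_apply_le (cosPoint x - cosPoint y) 0

theorem edist_cosPoint_le (x y : ℝ) :
    edist (cosPoint x) (cosPoint y) ≤ ENNReal.ofReal (8 * |x - y|) := by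
  rw [edist_dist, dist_eq_norm]
  refine ENNReal.ofReal_le_ofReal (abs_le_of_sq_le_sq' ?_ (by positivity)).2
  have h : ‖cosPoint x - cosPoint y‖ ^ 2 =
      (x - y) ^ 2 + (Real.cos (2 * Real.pi * x) - Real.cos (2 * Real.pi * y)) ^ 2 := by
    simp [EuclideanSpace.norm_sq_eq, cosPoint, Fin.sum_univ_two]
  have hc : |Real.cos (2 * Real.pi * x) - Real.cos (2 * Real.pi * y)| ≤ 2 * Real.pi * |x - y| := by
    have := Real.abs_cos_sub_cos_le (2 * Real.pi * x) (2 * Real.pi * y)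
    rwa [← mul_sub, abs_mul, abs_of_pos (by positivity : 0 < 2 * Real.pi)] at this
  have hc2 := pow_le_pow_left₀ (abs_nonneg _) hc 2
  rw [sq_abs, mul_pow, sq_abs] at hc2
  rw [h, mul_pow, sq_abs]
  -- The squared Lipschitz constant is `1 + 4π² ≤ 41 ≤ 8²`.
  have hpi : Real.pi ^ 2 ≤ 10 := by nlinarith [Real.pi_lt_d2, Real.pi_pos]
  nlinarith [mul_le_mul_of_nonneg_right hpi (sq_nonneg (x - y))]

theorem velocity_zeroPotential {Ω : Set (Rd 2)} {V : Rd 2 → ℝ} (μ ν : Measure (Rd 2)) (x : Rd 2) :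
    velocity Ω V zeroPotential μ x = velocity Ω V zeroPotential ν x := by
  simp [velocity, gradient_zeroPotential]

/-- An atomic measure on hill equilibria, one atom of which is replaced by an atom that follows the
boundary flow. -/
theorem isGlobalWeakSolution_atomic {w : ℕ → ℝ} (hw : ∀ k, 0 ≤ w k) (h1 : HasSum w 1)
    {p : ℕ → ℝ} (hp : ∀ k, 4 ≤ p k) (hp0 : ∀ k, cosSpeed (p k) = 0)
    (h2 : ∫⁻ x, ‖x‖ₑ ^ 2 ∂(atomic w fun k => cosPoint (p k)) < ⊤) (n : ℕ) {x : ℝ → ℝ}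
    (hx : ∀ t, HasDerivAt x (cosSpeed (x t)) t) (hx4 : ∀ t, 4 ≤ x t) :
    IsGlobalWeakSolution cosDomain saddle zeroPotential
      (atomic w (Function.update (fun k => cosPoint (p k)) n (cosPoint (x 0))))
      (fun t => atomic w (Function.update (fun k => cosPoint (p k)) n (cosPoint (x t)))) := by
  set z : ℕ → Rd 2 := fun k => cosPoint (p k) with hz
  have hac : ∀ {P : Rd 2 → Prop}, (∀ k, P (z k)) → ∀ᵐ y ∂(atomicErase w z n), P y := fun h =>
    ae_mono (atomicErase_le w z n) (ae_atomic w h)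
  have hxc : Continuous x := continuous_iff_continuousAt.2 fun t => (hx t).continuousAt
  simp only [atomic_update]
  refine isGlobalWeakSolution_add_dirac (u := velocity cosDomain saddle zeroPotential 0)
    (fun μ y => velocity_zeroPotential _ _ _) (X := fun t => cosPoint (x t)) ?_ ?_ ?_ ?_ ?_ ?_ ?_
  · rw [← atomic_univ hw h1 (Function.update z n 0), atomic_update]
    simp
  · exact hac (P := fun y => y ∈ closure cosDomain) fun k => cosPoint_mem_closure _
  · exact (lintegral_mono' (atomicErase_le w z n) le_rfl).trans_lt h2
  · exact hac fun k => by rw [hz, velocity_cosPoint _ (hp k), hp0, zero_smul]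
  · intro t
    rw [velocity_cosPoint _ (hx4 t)]
    exact hasDerivAt_cosPoint (hx t)
  · simp only [velocity_cosPoint _ (hx4 _)]
    refine (contDiff_cosSpeed.continuous.comp hxc).smul ?_
    refine (PiLp.continuous_toLp 2 _).comp (continuous_pi fun i => ?_)
    fin_cases i
    · exact continuous_const
    · exact (continuous_const.mul (Real.continuous_sin.comp (continuous_const.mul hxc))).neg
  · exact fun t => cosPoint_mem_closure _

theorem liminf_div_rpow_eq_top {a b : ℕ → ℝ≥0∞} {s e : ℕ → ℝ} {c C p : ℝ} (hc : 0 < c)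
    (hC : 0 < C) (hp : 0 < p) (ha : ∀ n, ENNReal.ofReal (c * s n) ≤ a n)
    (hb : ∀ n, b n ≤ ENNReal.ofReal (C * Real.exp (-e n)))
    (h : Tendsto (fun n => s n * Real.exp (p * e n)) atTop atTop) :
    liminf (fun n => a n / b n ^ p) atTop = ⊤ := by
  refine Tendsto.liminf_eq (tendsto_nhds_top_mono (f := fun n =>
    ENNReal.ofReal (c / C ^ p * (s n * Real.exp (p * e n)))) ?_ ?_)
  · exact ENNReal.tendsto_ofReal_atTop.comp (h.const_mul_atTop (by positivity))
  · refine Eventually.of_forall fun n => ?_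
    have hpos : 0 < (C * Real.exp (-e n)) ^ p := by positivity
    have e1 : c / C ^ p * (s n * Real.exp (p * e n)) = c * s n / (C * Real.exp (-e n)) ^ p := by
      rw [Real.mul_rpow hC.le (Real.exp_pos _).le, ← Real.exp_mul, neg_mul, Real.exp_neg,
        mul_comm (e n) p]
      field_simp
    simp only [e1]
    rw [ENNReal.ofReal_div_of_pos hpos, ← ENNReal.ofReal_rpow_of_pos (by positivity)]
    exact ENNReal.div_le_div (ha n) (ENNReal.rpow_le_rpow (hb n) hp.le)

/-- The construction common to both parts; only the weights remain free. The norm bounds on all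
atoms are exported so that decay can be read off from the weights. -/
theorem exists_perturbedSolutions {w : ℕ → ℝ} (hw : ∀ k, 0 < w k) (h1 : HasSum w 1)
    (hs : Summable fun k : ℕ => w k * ((k : ℝ) + 7) ^ 2) {t₀ : ℝ} (ht₀ : 0 < t₀) {q : ℝ}
    (hq : 0 < q)
    (hr : Tendsto (fun k : ℕ => √(w k) * Real.exp (q * (k / 2 * t₀))) atTop atTop) :
    ∃ (z : ℕ → Rd 2) (X : ℕ → ℝ → Rd 2),
      (∀ k : ℕ, (k : ℝ) ≤ ‖z k‖ ∧ ‖z k‖ ≤ k + 7) ∧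
      (∀ (n : ℕ) t, (n : ℝ) ≤ ‖X n t‖ ∧ ‖X n t‖ ≤ n + 7) ∧
      PerturbedSolutions (atomic w z) (fun n => atomic w (Function.update z n (X n 0)))
        (fun _ => atomic w z) (fun n t => atomic w (Function.update z n (X n t))) ∧
      liminf (fun n => dW (atomic w z) (atomic w (Function.update z n (X n t₀))) /
        dW (atomic w z) (atomic w (Function.update z n (X n 0))) ^ q) atTop = ⊤ := by
  -- Hills are numbered from `4`, where the projection is sure to be active.
  have hw0 : ∀ k, 0 ≤ w k := fun k => (hw k).le
  have hw1 : ∀ k, w k ≤ 1 := fun k => le_hasSum h1 k fun j _ => hw0 j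
  have hex : ∀ k : ℕ, ∃ p : ℝ, p ∈ Icc ((k + 4 : ℕ) : ℝ) ((k + 4 : ℕ) + 1 / 12) ∧
      cosSpeed p = 0 := fun k => exists_cosSpeed_eq_zero (by omega)
  choose p hp hp0 using hex
  have hlow : ∀ k : ℕ, (k : ℝ) + 4 ≤ p k := fun k => by simpa using (hp k).1
  have hup : ∀ k : ℕ, p k ≤ (k : ℝ) + 4 + 1 / 12 := fun k => by simpa using (hp k).2
  have hp4 : ∀ k, 4 ≤ p k := fun k => by linarith [hlow k, (Nat.cast_nonneg k : (0 : ℝ) ≤ k)]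
  have htraj : ∀ n : ℕ, ∃ x : ℝ → ℝ, x t₀ = (n : ℝ) + 4 + 1 / 6 ∧
      (∀ t, HasDerivAt x (cosSpeed (x t)) t) ∧ (∀ t, x t ∈ Ioo (p n) (p (n + 1))) ∧
      x 0 ≤ (n : ℝ) + 4 + 1 / 6 ∧ x 0 - p n ≤ Real.exp (-(((n : ℝ) + 4) / 2 * t₀)) := by
    intro n
    have h := hlow (n + 1)
    push_cast at h
    simpa using exists_trajectory (N := n + 4) (by omega) (hp n) (hp0 n) (p' := p (n + 1))
      (by push_cast; linarith) (hp0 (n + 1)) ht₀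
  choose x hxt hxd hxm hx0 hxe using htraj
  have hnorm : ∀ (n : ℕ) (y : ℝ), p n ≤ y → y ≤ p (n + 1) →
      (n : ℝ) ≤ ‖cosPoint y‖ ∧ ‖cosPoint y‖ ≤ n + 7 := by
    intro n y h1 h2
    have h3 := abs_le_norm_cosPoint y
    have h4 := norm_cosPoint_le y
    have h5 := hlow n
    have h6 := hup (n + 1)
    push_cast at h6
    rw [abs_of_nonneg (by linarith [hp4 n])] at h3 h4
    constructor <;> linarith
  have hmono : Monotone p := monotone_nat_of_le_succ fun n =>
    ((hxm n 0).1.trans (hxm n 0).2).le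
  set z : ℕ → Rd 2 := fun k => cosPoint (p k) with hz
  have hzn : ∀ k : ℕ, (k : ℝ) ≤ ‖z k‖ ∧ ‖z k‖ ≤ k + 7 := fun k =>
    hnorm k (p k) le_rfl (hmono (Nat.le_succ k))
  have h2 : ∫⁻ y, ‖y‖ₑ ^ 2 ∂(atomic w z) < ⊤ := by
    refine (lintegral_atomic_le hw0 (fun k => by positivity) hs fun k => ?_).trans_lt
      ENNReal.ofReal_lt_top
    rw [← ofReal_norm, ← ENNReal.ofReal_pow (norm_nonneg _)]
    have := (hzn k).2
    gcongr
  have hx4 : ∀ n t, 4 ≤ x n t := fun n t => (hp4 n).trans (hxm n t).1.le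
  have hsol : ∀ n, IsGlobalWeakSolution cosDomain saddle zeroPotential
      (atomic w (Function.update z n (cosPoint (x n 0))))
      (fun t => atomic w (Function.update z n (cosPoint (x n t)))) := fun n =>
    isGlobalWeakSolution_atomic hw0 h1 hp4 hp0 h2 n (hxd n) (hx4 n)
  -- The resting measure is the case of a constant trajectory for atom `0`.
  have hsol0 : IsGlobalWeakSolution cosDomain saddle zeroPotential (atomic w z)
      (fun _ => atomic w z) := by
    have := isGlobalWeakSolution_atomic hw0 h1 hp4 hp0 h2 0 (x := fun _ => p 0)
      (fun t => by rw [hp0]; exact hasDerivAt_const t _) (fun _ => hp4 0)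
    simpa [hz, Function.update_eq_self (f := fun k => cosPoint (p k)) 0] using this
  -- The nearest equilibrium to `y` is `p n`: those further right are at least `5/6` away, while `y
  -- - p n ≤ 1/6`.
  have hlower : ∀ (n : ℕ) (y : ℝ), p n ≤ y → y ≤ (n : ℝ) + 4 + 1 / 6 →
      ENNReal.ofReal (w n) ^ (1 / 2 : ℝ) * ENNReal.ofReal (y - p n) ≤
        dW (atomic w z) (atomic w (Function.update z n (cosPoint y))) := by
    intro n y hy1 hy2
    refine le_dW_of_atom (q := cosPoint y) ?_ (ae_atomic w fun k => ?_)
    · simpa using ofReal_le_atomic w (Function.update z n (cosPoint y)) n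
    · refine le_trans (ENNReal.ofReal_le_ofReal ?_) (ofReal_abs_sub_le_edist_cosPoint (p k) y)
      rcases le_or_gt k n with h | h
      · rw [abs_sub_comm]
        exact le_trans (by linarith [hmono h]) (le_abs_self _)
      · have h3 := hmono (Nat.succ_le_of_lt h)
        have h4 := hlow (n + 1)
        push_cast at h4
        refine le_trans ?_ (le_abs_self _)
        linarith [hlow n]
  have hupper : ∀ n : ℕ, dW (atomic w z) (atomic w (Function.update z n (cosPoint (x n 0)))) ≤
      ENNReal.ofReal (8 * Real.exp (-((n : ℝ) / 2 * t₀))) := by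
    intro n
    have e : atomic w z = atomic w (Function.update z n (z n)) := by
      rw [Function.update_eq_self]
    rw [e, atomic_update, atomic_update]
    refine (dW_add_dirac_le _ _ _ _).trans ?_
    -- The factor `√(w n)` is simply bounded by `1`; the growth hypothesis `hr` pays for this.
    calc ENNReal.ofReal (w n) ^ (1 / 2 : ℝ) * edist (z n) (cosPoint (x n 0))
        ≤ 1 * ENNReal.ofReal (8 * |p n - x n 0|) := by
          gcongr
          · exact ENNReal.rpow_le_one (ENNReal.ofReal_le_one.2 (hw1 n)) (by norm_num)
          · exact edist_cosPoint_le _ _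
      _ ≤ _ := by
          rw [one_mul, abs_sub_comm, abs_of_pos (by linarith [(hxm n 0).1])]
          refine ENNReal.ofReal_le_ofReal (mul_le_mul_of_nonneg_left ((hxe n).trans ?_)
            (by norm_num))
          rw [Real.exp_le_exp]
          nlinarith
  have hsqrt : ∀ n, ENNReal.ofReal (w n) ^ (1 / 2 : ℝ) = ENNReal.ofReal √(w n) := by
    intro n
    rw [ENNReal.ofReal_rpow_of_pos (hw n), Real.sqrt_eq_rpow]
  refine ⟨z, fun n t => cosPoint (x n t), hzn,
    fun n t => hnorm n _ (hxm n t).1.le (hxm n t).2.le, ⟨?_, ?_, hsol0, hsol, ?_, ?_⟩, ?_⟩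
  · exact (hsol0 1 one_pos).memP2 0 ⟨le_rfl, zero_le_one⟩
  · exact fun n => (hsol n 1 one_pos).memP2 0 ⟨le_rfl, zero_le_one⟩
  · intro n
    have h3 := hlower n (x n 0) (hxm n 0).1.le (hx0 n)
    rw [hsqrt, ← ENNReal.ofReal_mul (Real.sqrt_nonneg _)] at h3
    refine (lt_of_lt_of_le (ENNReal.ofReal_pos.2 ?_) h3).ne'
    exact mul_pos (Real.sqrt_pos.2 (hw n)) (sub_pos.2 (hxm n 0).1)
  · refine tendsto_of_tendsto_of_tendsto_of_le_of_le tendsto_const_nhds ?_ (fun n => zero_le) hupper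
    have h3 : Tendsto (fun n : ℕ => (n : ℝ) / 2 * t₀) atTop atTop :=
      (tendsto_natCast_atTop_atTop.atTop_div_const two_pos).atTop_mul_const ht₀
    have h4 := (Real.tendsto_exp_neg_atTop_nhds_zero.comp h3).const_mul 8
    simpa using ENNReal.tendsto_ofReal h4
  · refine liminf_div_rpow_eq_top (c := 1 / 12) (C := 8) (s := fun n => √(w n))
      (e := fun n => (n : ℝ) / 2 * t₀) (by norm_num) (by norm_num) hq (fun n => ?_) hupper hr
    have h3 := hlower n (x n t₀) (hxm n t₀).1.le (hxt n).le
    rw [hsqrt, ← ENNReal.ofReal_mul (Real.sqrt_nonneg _)] at h3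
    refine le_trans (ENNReal.ofReal_le_ofReal ?_) h3
    rw [mul_comm, hxt]
    refine mul_le_mul_of_nonneg_left ?_ (Real.sqrt_nonneg _)
    linarith [hup n]

/-! ### The two choices of weights -/

theorem exists_superlinear_instability {t₀ : ℝ} (ht₀ : 0 < t₀) :
    ∃ (μ₀ : Measure (Rd 2)) (μ₀n : ℕ → Measure (Rd 2))
      (μ : ℝ → Measure (Rd 2)) (μn : ℕ → ℝ → Measure (Rd 2)),
      PerturbedSolutions μ₀ μ₀n μ μn ∧
      (∀ T : ℝ, 0 < T → ∃ c > 0, ∀ t ∈ Icc 0 T,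
        ConditionRWith c (μ t) ∧ ∀ n, ConditionRWith c (μn n t)) ∧
      liminf (fun n => dW (μ t₀) (μn n t₀) / dW μ₀ (μ₀n n)) atTop = ⊤ := by
  -- With weights of order `exp (-a n)`, `√(w n)` loses `exp (-a n / 2)` against the gain `exp (a
  -- n)`. The decay constant `a / 4` below costs `exp (a n / 2)` in the moment, which the weights
  -- absorb.
  set a := t₀ / 2 with ha
  have ha0 : 0 < a := by positivity
  have hr1 : Real.exp (-a) < 1 := by rw [Real.exp_lt_one_iff]; linarith
  set w : ℕ → ℝ := fun k => (1 - Real.exp (-a)) * Real.exp (-a) ^ k with hw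
  have hexp : ∀ k : ℕ, Real.exp (-a) ^ k = Real.exp (-(a * k)) := by
    intro k
    rw [← Real.exp_nat_mul]
    congr 1
    ring
  have hw0 : ∀ k, 0 < w k := fun k => mul_pos (by linarith) (by positivity)
  have h1 : HasSum w 1 := by
    have := (hasSum_geometric_of_lt_one (Real.exp_pos _).le hr1).mul_left (1 - Real.exp (-a))
    rwa [mul_inv_cancel₀ (by linarith)] at this
  have hsum : Summable fun k : ℕ =>
      w k * (((k : ℝ) + 7) ^ 2 * Real.exp (2 * (a / 4) * (k + 7))) := by
    have h := (summable_nat_add_iff 7).2 (Real.summable_pow_mul_exp_neg_nat_mul 2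
      (r := a / 2) (by positivity))
    refine (h.mul_left ((1 - Real.exp (-a)) * Real.exp (7 * a))).congr fun k => ?_
    simp only [hw, hexp]
    have e : Real.exp (7 * a) * Real.exp (-(a / 2) * ((k + 7 : ℕ) : ℝ)) =
        Real.exp (-(a * k)) * Real.exp (2 * (a / 4) * (k + 7)) := by
      rw [← Real.exp_add, ← Real.exp_add]
      congr 1
      push_cast
      ring
    calc _ = (1 - Real.exp (-a)) * ((k : ℝ) + 7) ^ 2 *
          (Real.exp (7 * a) * Real.exp (-(a / 2) * ((k + 7 : ℕ) : ℝ))) := by push_cast; ring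
      _ = _ := by rw [e]; ring
  have hsum2 : Summable fun k : ℕ => w k * ((k : ℝ) + 7) ^ 2 := by
    refine hsum.of_nonneg_of_le (fun k => mul_nonneg (hw0 k).le (by positivity)) fun k => ?_
    refine mul_le_mul_of_nonneg_left (le_mul_of_one_le_right (by positivity) ?_) (hw0 k).le
    exact Real.one_le_exp (by positivity)
  have hr : Tendsto (fun k : ℕ => √(w k) * Real.exp (1 * (k / 2 * t₀))) atTop atTop := by
    have h : Tendsto (fun k : ℕ => √(1 - Real.exp (-a)) * Real.exp ((a / 2) * k)) atTop atTop :=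
      (Real.tendsto_exp_atTop.comp
        (tendsto_natCast_atTop_atTop.const_mul_atTop (by positivity))).const_mul_atTop
        (Real.sqrt_pos.2 (by linarith))
    refine h.congr fun k => ?_
    simp only [hw]
    rw [Real.sqrt_mul (by linarith), hexp, mul_assoc, Real.sqrt_eq_rpow (Real.exp _),
      ← Real.exp_mul, ← Real.exp_add]
    congr 2
    rw [ha]
    ring
  obtain ⟨z, X, hz, hX, hP, hlim⟩ := exists_perturbedSolutions hw0 h1 hsum2 ht₀ one_pos hr
  have hR : ∀ y : ℕ → Rd 2, (∀ k : ℕ, ‖y k‖ ≤ k + 7) → ConditionRWith (a / 4) (atomic w y) := by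
    intro y hy
    refine conditionRWith_of_lintegral (by positivity) ?_
    refine (lintegral_atomic_le (fun k => (hw0 k).le) (fun k => by positivity) hsum
      fun k => ?_).trans_lt ENNReal.ofReal_lt_top
    rw [← ofReal_norm, ← ENNReal.ofReal_pow (norm_nonneg _),
      ← ENNReal.ofReal_mul (by positivity)]
    have := hy k
    gcongr
  refine ⟨_, _, _, _, hP, fun T _ => ⟨a / 4, by positivity, fun t _ => ⟨hR z fun k => (hz k).2,
    fun n => hR _ fun k => ?_⟩⟩, by simpa using hlim⟩
  rcases eq_or_ne k n with rfl | h
  · simpa using (hX k t).2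
  · rw [Function.update_of_ne h]
    exact (hz k).2

theorem tendsto_exp_div_pow_nat_atTop (n : ℕ) {b : ℝ} (hb : 0 < b) :
    Tendsto (fun k : ℕ => Real.exp (b * k) / ((k : ℝ) + 1) ^ n) atTop atTop := by
  have h := ((tendsto_exp_mul_div_rpow_atTop n b hb).comp (tendsto_atTop_add_const_right atTop 1
    (tendsto_natCast_atTop_atTop (R := ℝ)))).const_mul_atTop (Real.exp_pos (-b))
  refine h.congr fun k => ?_
  simp only [Function.comp_apply, Real.rpow_natCast]
  rw [← mul_div_assoc, ← Real.exp_add]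
  congr 2
  ring

theorem exists_holder_instability {t₀ : ℝ} (ht₀ : 0 < t₀) {p : ℝ} (hp : 0 < p) :
    ∃ (μ₀ : Measure (Rd 2)) (μ₀n : ℕ → Measure (Rd 2))
      (μ : ℝ → Measure (Rd 2)) (μn : ℕ → ℝ → Measure (Rd 2)),
      PerturbedSolutions μ₀ μ₀n μ μn ∧
      (∃ C q : ℝ, 0 < q ∧ PolynomialDecayWith C q μ₀ ∧ ∀ n, PolynomialDecayWith C q (μ₀n n)) ∧
      ¬ ConditionR μ₀ ∧ (∀ n, ¬ ConditionR (μ₀n n)) ∧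
      liminf (fun n => dW (μ t₀) (μn n t₀) / dW μ₀ (μ₀n n) ^ p) atTop = ⊤ := by
  have hsummable : ∀ m : ℕ, 1 < m → Summable fun k : ℕ => (((k : ℝ) + 1) ^ m)⁻¹ := by
    intro m hm
    have := (summable_nat_add_iff 1).2 (Real.summable_nat_pow_inv.2 hm)
    simpa using this
  -- The power `6` has a rational square root and leaves a summable power `3` after the third
  -- moment, which gives the decay exponent `1`.
  set S := ∑' k : ℕ, (((k : ℝ) + 1) ^ 6)⁻¹ with hS
  have hS0 : 0 < S := (hsummable 6 (by norm_num)).tsum_pos (fun k => by positivity) 0 (by positivity)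
  set w : ℕ → ℝ := fun k => S⁻¹ * (((k : ℝ) + 1) ^ 6)⁻¹ with hw
  have hw0 : ∀ k, 0 < w k := fun k => by simp only [hw]; positivity
  have h1 : HasSum w 1 := by
    have := (hsummable 6 (by norm_num)).hasSum.mul_left S⁻¹
    rwa [← hS, inv_mul_cancel₀ hS0.ne'] at this
  have hsum : Summable fun k : ℕ => w k * ((k : ℝ) + 7) ^ 3 := by
    refine ((hsummable 3 (by norm_num)).mul_left (343 * S⁻¹)).of_nonneg_of_le
      (fun k => by positivity) fun k => ?_
    have h7 : ((k : ℝ) + 7) ^ 3 ≤ (7 * ((k : ℝ) + 1)) ^ 3 := by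
      gcongr
      linarith [(Nat.cast_nonneg k : (0 : ℝ) ≤ k)]
    calc w k * ((k : ℝ) + 7) ^ 3 ≤ w k * (7 * ((k : ℝ) + 1)) ^ 3 :=
          mul_le_mul_of_nonneg_left h7 (hw0 k).le
      _ = 343 * S⁻¹ * (((k : ℝ) + 1) ^ 3)⁻¹ := by
          simp only [hw]
          field_simp
          norm_num
  have hsum2 : Summable fun k : ℕ => w k * ((k : ℝ) + 7) ^ 2 := by
    refine hsum.of_nonneg_of_le (fun k => by positivity) fun k => ?_
    refine mul_le_mul_of_nonneg_left (pow_le_pow_right₀ ?_ (by norm_num)) (hw0 k).le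
    linarith [(Nat.cast_nonneg k : (0 : ℝ) ≤ k)]
  have hr : Tendsto (fun k : ℕ => √(w k) * Real.exp (p * (k / 2 * t₀))) atTop atTop := by
    have h := (tendsto_exp_div_pow_nat_atTop 3 (b := p * t₀ / 2) (by positivity)).const_mul_atTop
      (Real.sqrt_pos.2 (inv_pos.2 hS0))
    refine h.congr fun k => ?_
    simp only [hw]
    rw [Real.sqrt_mul (by positivity), Real.sqrt_inv (_ ^ 6),
      show ((k : ℝ) + 1) ^ 6 = (((k : ℝ) + 1) ^ 3) ^ 2 by ring, Real.sqrt_sq (by positivity),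
      div_eq_inv_mul, mul_assoc]
    congr 3
    ring
  have hwexp : ∀ c > 0, Tendsto (fun k : ℕ => w k * Real.exp (c * k)) atTop atTop := by
    intro c hc
    refine ((tendsto_exp_div_pow_nat_atTop 6 hc).const_mul_atTop (inv_pos.2 hS0)).congr fun k => ?_
    simp only [hw]
    rw [div_eq_inv_mul, mul_assoc]
  obtain ⟨z, X, hz, hX, hP, hlim⟩ := exists_perturbedSolutions hw0 h1 hsum2 ht₀ hp hr
  have hdecay : ∀ y : ℕ → Rd 2, (∀ k : ℕ, ‖y k‖ ≤ k + 7) →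
      PolynomialDecayWith (∑' k : ℕ, w k * ((k : ℝ) + 7) ^ 3) 1 (atomic w y) := by
    intro y hy
    refine polynomialDecayWith_of_lintegral (lintegral_atomic_le (fun k => (hw0 k).le)
      (fun k => by positivity) hsum fun k => ?_)
    rw [← ofReal_norm, ← ENNReal.ofReal_pow (norm_nonneg _)]
    have := hy k
    gcongr
  have hnotR : ∀ y : ℕ → Rd 2, (∀ k : ℕ, (k : ℝ) ≤ ‖y k‖) → ¬ ConditionR (atomic w y) :=
    fun y hy => not_conditionR_of_atoms hy (Eventually.of_forall (ofReal_le_atomic w y)) hwexp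
  have hupd : ∀ n k : ℕ, (k : ℝ) ≤ ‖Function.update z n (X n 0) k‖ ∧
      ‖Function.update z n (X n 0) k‖ ≤ k + 7 := by
    intro n k
    rcases eq_or_ne k n with rfl | h
    · simpa using hX k 0
    · rw [Function.update_of_ne h]
      exact hz k
  exact ⟨_, _, _, _, hP, ⟨_, 1, one_pos, hdecay z fun k => (hz k).2,
    fun n => hdecay _ fun k => (hupd n k).2⟩, hnotR z fun k => (hz k).1,
    fun n => hnotR _ fun k => (hupd n k).1, hlim⟩

end ProjectedFlow

theorem theorem3p6 :
    -- the stationary, unbounded, non-convex domain and the potentials satisfy the assumptions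
    ProjectedFlow.ConditionO1 ProjectedFlow.cosDomain ∧
    ¬ Convex ℝ ProjectedFlow.cosDomain ∧
    ¬ Bornology.IsBounded ProjectedFlow.cosDomain ∧
    ProjectedFlow.ConditionC1 ProjectedFlow.saddle ∧
    ProjectedFlow.ConditionC2 ProjectedFlow.zeroPotential ∧
    ProjectedFlow.ConditionC3 ProjectedFlow.saddle ProjectedFlow.zeroPotential ∧
    ∀ t₀ : ℝ, 0 < t₀ →
      -- (i)
      (∃ (μ₀ : Measure (ProjectedFlow.Rd 2)) (μ₀n : ℕ → Measure (ProjectedFlow.Rd 2))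
          (μ : ℝ → Measure (ProjectedFlow.Rd 2)) (μn : ℕ → ℝ → Measure (ProjectedFlow.Rd 2)),
        ProjectedFlow.PerturbedSolutions μ₀ μ₀n μ μn ∧
        (∀ T : ℝ, 0 < T → ∃ c > 0, ∀ t ∈ Icc 0 T,
          ProjectedFlow.ConditionRWith c (μ t) ∧
          ∀ n, ProjectedFlow.ConditionRWith c (μn n t)) ∧
        liminf (fun n => ProjectedFlow.dW (μ t₀) (μn n t₀) / ProjectedFlow.dW μ₀ (μ₀n n)) atTop
          = ⊤) ∧
      -- (ii)
      (∀ p : ℝ, 1 / 2 < p →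
        ∃ (μ₀ : Measure (ProjectedFlow.Rd 2)) (μ₀n : ℕ → Measure (ProjectedFlow.Rd 2))
          (μ : ℝ → Measure (ProjectedFlow.Rd 2)) (μn : ℕ → ℝ → Measure (ProjectedFlow.Rd 2)),
        ProjectedFlow.PerturbedSolutions μ₀ μ₀n μ μn ∧
        (∃ C q : ℝ, 0 < q ∧ ProjectedFlow.PolynomialDecayWith C q μ₀ ∧
          ∀ n, ProjectedFlow.PolynomialDecayWith C q (μ₀n n)) ∧
        ¬ ProjectedFlow.ConditionR μ₀ ∧ (∀ n, ¬ ProjectedFlow.ConditionR (μ₀n n)) ∧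
        liminf (fun n => ProjectedFlow.dW (μ t₀) (μn n t₀) / ProjectedFlow.dW μ₀ (μ₀n n) ^ p)
          atTop = ⊤) :=
  ⟨ProjectedFlow.conditionO1_cosDomain, ProjectedFlow.not_convex_cosDomain,
    ProjectedFlow.not_isBounded_cosDomain, ProjectedFlow.conditionC1_saddle,
    ProjectedFlow.conditionC2_zeroPotential, ProjectedFlow.conditionC3_saddle, fun _ ht₀ =>
    ⟨ProjectedFlow.exists_superlinear_instability ht₀, fun _ hp =>
      ProjectedFlow.exists_holder_instability ht₀ (one_half_pos.trans hp)⟩⟩
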